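/- Let $\mathbb K$ be an algebraically closed field (of any characteristic), let $I\subset\mathbb K[x_1,\dots,x_n]$ be an ideal and $V(I)\subset\mathbb K^n$ its zero set. For $\omega\in\mathbb R^n$ and a polynomial $f$ let $\mathrm{In}_\omega f$ be the sum of the terms $a_\mu x^\mu$ of $f$ (with $a_\mu\ne0$) for which $\omega\cdot\mu$ is minimal, and let $\mathfrak{In}_\omega I=\langle \mathrm{In}_\omega f: f\in I\rangle$. The tropical variety of $I$ is $\mathbf{TV}(I)=\{\omega\in\mathbb R^n:\mathfrak{In}_\omega I\text{ contains no monomial}\}$. Put $C_\omega(I)=\overline{\{u\in\mathbb R^n:\mathfrak{In}_uI=\mathfrak{In}_\omega I\}}$ (closure in $\mathbb R^n$) and, for $J\subset\{1,\dots,n\}$, let $E_J$ be the cone generated by the standard basis vectors $e^{(j)}$, $j\in J$. The Gröbner fan of $I$ is $\Sigma(I)=\{C_\omega(I)\cap E_J:\omega\in\mathbb R^n,\ J\subset\{1,\dots,n\}\}$. Let $\Sigma$ be a regular refinement of $\Sigma(I)$, that is, a finite fan with support in $(\mathbb R_{\ge0})^n$, each of whose cones is regular (generated by a $\mathbb Z$-basis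 of the group of integer points of its linear span), and such that every member of $\Sigma(I)$ is a union of cones of $\Sigma$. For a unimodular integer matrix $N$ let $\phi_N$ be the rational map of $\mathbb K^n$ whose $i$-th coordinate is the Laurent monomial with exponent the $i$-th column of $N$. The toric variety $X_\Sigma$ is obtained from copies $U_\sigma$ of $\mathbb K^n$, one for each $n$-dimensional cone $\sigma=\mathrm{Cone}(M)\in\Sigma$ (generated by the columns of $M\in GL(n,\mathbb Z)$), by identifying $u\in U_{\mathrm{Cone}(M)}$ with $u'\in U_{\mathrm{Cone}(M')}$ whenever $\phi_{M^t(M'^{-1})^t}$ is biregular at $u$ and sends $u$ to $u'$. The toric modification $\pi:X_\Sigma\to\mathbb K^n$ is given by $\phi_{M^t}$ on $U_{\mathrm{Cone}(M)}$. The strict transform of $V(I)$ is the Zariski closure $$\widetilde{V(I)}=\overline{\pi^{-1}\bigl(\{x\in V(I): x_1\cdots x_n\neq0\}\bigr)}\subset X_\Sigma .$$ If $\tau\in\Sigma$ is generated by the columns of $M$ with index in $\lambda\subset\{1,\dots,n\}$, where $\mathrm{Cone}(M)\in\Sigma$ is $n$-dimensional, the orbit of $\tau$ is $\mathcal O(\tau)=\{x\in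 U_{\mathrm{Cone}(M)}: x_i=0\Leftrightarrow i\in\lambda\}\subset X_\Sigma$. Then, for every $\tau\in\Sigma$, $$\widetilde{V(I)}\cap\mathcal O(\tau)\neq\emptyset\iff\tau\subset\mathbf{TV}(I).$$ -/

import Mathlib

open scoped Matrix

noncomputable section

namespace ToricTropical

/-! ### Cones and fans -/

/-- The polyhedral cone generated by a finite family of vectors. -/
def coneGen {n : ℕ} {ι : Type} [Fintype ι] (u : ι → Fin n → ℝ) : Set (Fin n → ℝ) :=
  {x | ∃ c : ι → ℝ, (∀ i, 0 ≤ c i) ∧ x = ∑ i, c i • u i}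

/-- An integer vector, seen as a real vector. -/
def toReal {n : ℕ} (v : Fin n → ℤ) : Fin n → ℝ := fun i => (v i : ℝ)

/-- The first orthant of `ℝⁿ`. -/
def orthant (n : ℕ) : Set (Fin n → ℝ) := {x | ∀ i, 0 ≤ x i}

/-- The cone `E_J` generated by the standard basis vectors `e⁽ʲ⁾`, `j ∈ J`. -/
def coordCone {n : ℕ} (J : Finset (Fin n)) : Set (Fin n → ℝ) :=
  coneGen fun j : J => (Pi.single (j : Fin n) 1 : Fin n → ℝ)

/-- The dual of a cone. -/
def dualCone {n : ℕ} (σ : Set (Fin n → ℝ)) : Set (Fin n → ℝ) :=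
  {v | ∀ x ∈ σ, 0 ≤ v ⬝ᵥ x}

/-- `τ` is a face of the cone `σ`: it is cut out by a supporting hyperplane
(`v = 0` gives `σ` itself). -/
def IsFace {n : ℕ} (τ σ : Set (Fin n → ℝ)) : Prop :=
  ∃ v ∈ dualCone σ, τ = {x ∈ σ | v ⬝ᵥ x = 0}

/-- A regular cone: it is generated by integer vectors that form a `ℤ`-basis of the group of
integer points in the linear span of the cone. -/
def IsRegularCone {n : ℕ} (σ : Set (Fin n → ℝ)) : Prop :=
  ∃ (k : ℕ) (u : Fin k → Fin n → ℤ),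
    σ = coneGen (fun i => toReal (u i)) ∧
    LinearIndependent ℤ u ∧
    ∀ v : Fin n → ℤ, toReal v ∈ Submodule.span ℝ σ ↔ v ∈ Submodule.span ℤ (Set.range u)

/-- A (finite) regular polyhedral fan in `ℝⁿ` with support in the first orthant. -/
structure RegularFan (n : ℕ) where
  /-- the cones of the fan -/
  cones : Set (Set (Fin n → ℝ))
  finite : cones.Finite
  regular : ∀ σ ∈ cones, IsRegularCone σ
  face_mem : ∀ σ ∈ cones, ∀ τ, IsFace τ σ → τ ∈ cones
  inter_face : ∀ σ ∈ cones, ∀ τ ∈ cones, IsFace (σ ∩ τ) σ ∧ IsFace (σ ∩ τ) τ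
  subset_orthant : ∀ σ ∈ cones, σ ⊆ orthant n

/-- `F'` refines `F`: every cone of `F` is a union of cones of `F'`. -/
def IsRefinement {n : ℕ} (F' F : Set (Set (Fin n → ℝ))) : Prop :=
  ∀ σ ∈ F, ∃ S ⊆ F', σ = ⋃₀ S

/-! ### Initial ideals, the Gröbner fan and the tropical variety -/

section Initial

variable {K : Type*} [Field K] {n : ℕ}

/-- The scalar product `ω · μ` of a weight vector and an exponent. -/
def weight (ω : Fin n → ℝ) (μ : Fin n →₀ ℕ) : ℝ := ∑ i, ω i * (μ i : ℝ)

open Classical in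
/-- The `ω`-initial part of `f`: the sum of the terms of `f` of minimal `ω`-weight. -/
def initialForm (ω : Fin n → ℝ) (f : MvPolynomial (Fin n) K) : MvPolynomial (Fin n) K :=
  ∑ μ ∈ f.support.filter (fun μ => ∀ μ' ∈ f.support, weight ω μ ≤ weight ω μ'),
    MvPolynomial.monomial μ (f.coeff μ)

/-- The `ω`-initial ideal of `I`. -/
def initialIdeal (ω : Fin n → ℝ) (I : Ideal (MvPolynomial (Fin n) K)) :
    Ideal (MvPolynomial (Fin n) K) :=
  Ideal.span (initialForm ω '' (I : Set (MvPolynomial (Fin n) K)))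

/-- `C_ω(I)`: the closure in `ℝⁿ` of the set of weights with the same initial ideal as `ω`. -/
def groebnerCone (I : Ideal (MvPolynomial (Fin n) K)) (ω : Fin n → ℝ) : Set (Fin n → ℝ) :=
  closure {u | initialIdeal u I = initialIdeal ω I}

/-- The Gröbner fan of `I`: the intersections of the `C_ω(I)` with the faces of the first
orthant. -/
def groebnerFan (I : Ideal (MvPolynomial (Fin n) K)) : Set (Set (Fin n → ℝ)) :=
  {σ | ∃ (ω : Fin n → ℝ) (J : Finset (Fin n)), σ = groebnerCone I ω ∩ coordCone J}

/-- The tropical variety of `I`: the weights whose initial ideal contains no monomial. -/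
def tropicalVariety (I : Ideal (MvPolynomial (Fin n) K)) : Set (Fin n → ℝ) :=
  {ω | ∀ μ : Fin n →₀ ℕ, MvPolynomial.monomial μ (1 : K) ∉ initialIdeal ω I}

end Initial

/-! ### Monomial transformations -/

section Monomial

variable {K : Type*} [Field K] {n : ℕ}

/-- The monomial map `φ_N`; its `i`-th coordinate is the Laurent monomial whose exponent is the
`i`-th column of `N`. Its value is meaningful at the points where it is regular. -/
def monomialMap (N : Matrix (Fin n) (Fin n) ℤ) (x : Fin n → K) : Fin n → K :=
  fun i => ∏ j, x j ^ N j i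

/-- The rational map `φ_N` is regular at `x`: no coordinate that vanishes at `x` occurs in a
denominator of `φ_N`. -/
def RegularAt (N : Matrix (Fin n) (Fin n) ℤ) (x : Fin n → K) : Prop :=
  ∀ i j, N j i < 0 → x j ≠ 0

theorem regularAt_mul {N N' : Matrix (Fin n) (Fin n) ℤ} {x : Fin n → K}
    (h : RegularAt N x) (h' : RegularAt N' (monomialMap N x)) :
    RegularAt (N * N') x := by
  intro i j hneg hx
  rw [Matrix.mul_apply] at hneg
  refine absurd hneg (not_lt.mpr (Finset.sum_nonneg fun k _ => ?_))
  have h0 : 0 ≤ N j k := not_lt.mp fun hlt => h k j hlt hx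
  rcases h0.eq_or_lt with h0 | h0
  · simp [← h0]
  · have : monomialMap N x k = 0 :=
      Finset.prod_eq_zero (Finset.mem_univ j) (by rw [hx, zero_zpow _ h0.ne'])
    exact mul_nonneg h0.le (not_lt.mp fun hlt => h' i k hlt this)

theorem monomialMap_mul {N N' : Matrix (Fin n) (Fin n) ℤ} {x : Fin n → K}
    (h : RegularAt N x) (h' : RegularAt N' (monomialMap N x)) :
    monomialMap N' (monomialMap N x) = monomialMap (N * N') x := by
  funext i
  have key : ∀ j, ∏ k, (x j ^ N j k) ^ N' k i = x j ^ (N * N') j i := by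
    intro j
    rw [Matrix.mul_apply]
    by_cases hx : x j = 0
    · have hN : ∀ k, 0 ≤ N j k := fun k => not_lt.mp fun hlt => h k j hlt hx
      have hN' : ∀ k, 0 < N j k → 0 ≤ N' k i := fun k hk => by
        have : monomialMap N x k = 0 :=
          Finset.prod_eq_zero (Finset.mem_univ j) (by rw [hx, zero_zpow _ hk.ne'])
        exact not_lt.mp fun hlt => h' i k hlt this
      have hnn : ∀ k, 0 ≤ N j k * N' k i := fun k => by
        rcases (hN k).eq_or_lt with h0 | h0
        · simp [← h0]
        · exact mul_nonneg h0.le (hN' k h0)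
      simp_rw [← zpow_mul, hx]
      by_cases hs : ∑ k, N j k * N' k i = 0
      · have hz := (Finset.sum_eq_zero_iff_of_nonneg fun k _ => hnn k).mp hs
        rw [hs, zpow_zero]
        exact Finset.prod_eq_one fun k hk => by rw [hz k hk, zpow_zero]
      · rw [zero_zpow _ hs]
        obtain ⟨k, hk, hne⟩ := Finset.exists_ne_zero_of_sum_ne_zero hs
        exact Finset.prod_eq_zero hk (zero_zpow _ hne)
    · simp_rw [← zpow_mul]
      induction (Finset.univ : Finset (Fin n)) using Finset.induction_on with
      | empty => simp
      | insert a s ha ih =>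
        rw [Finset.prod_insert ha, Finset.sum_insert ha, zpow_add₀ hx, ih]
  simp only [monomialMap, ← Finset.prod_zpow]
  rw [Finset.prod_comm]
  exact Finset.prod_congr rfl fun j _ => key j

theorem monomialMap_one (x : Fin n → K) : monomialMap 1 x = x := by
  funext i
  rw [monomialMap, Finset.prod_eq_single i]
  · simp
  · intro j _ hj
    simp [Matrix.one_apply_ne hj]
  · simp

theorem regularAt_of_nonneg {N : Matrix (Fin n) (Fin n) ℤ} (hN : ∀ i j, 0 ≤ N i j)
    (x : Fin n → K) : RegularAt N x :=
  fun i j hlt => absurd (hN j i) (not_le.mpr hlt)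

end Monomial

/-! ### The toric variety of a regular fan and its toric modification -/

section Toric

variable {n : ℕ}

/-- The `j`-th column of `M`, as a real vector. -/
def column (M : GL (Fin n) ℤ) (j : Fin n) : Fin n → ℝ := toReal fun i => M.val i j

/-- The unimodular matrices `M` with `Cone(M)` in the fan. They index the charts; a cone of
maximal dimension occurs once for each ordering of its vertices, and the corresponding charts
are identified with each other by the gluing. -/
def MaxCone (F : RegularFan n) : Type :=
  {M : GL (Fin n) ℤ // coneGen (column M) ∈ F.cones}

/-- The exponent matrix `Mᵗ(M'⁻¹)ᵗ` of the change of charts from `M` to `M'`. -/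
def transition (M M' : GL (Fin n) ℤ) : Matrix (Fin n) (Fin n) ℤ :=
  M.valᵀ * (M'⁻¹).valᵀ

theorem transition_self (M : GL (Fin n) ℤ) : transition M M = 1 := by
  rw [transition, ← Matrix.transpose_mul, Units.inv_mul, Matrix.transpose_one]

theorem transition_mul_transpose (M M' : GL (Fin n) ℤ) :
    transition M M' * M'.valᵀ = M.valᵀ := by
  rw [transition, Matrix.mul_assoc, ← Matrix.transpose_mul, Units.mul_inv,
    Matrix.transpose_one, Matrix.mul_one]

theorem transition_mul (M M' M'' : GL (Fin n) ℤ) :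
    transition M M' * transition M' M'' = transition M M'' := by
  conv_lhs => rw [transition.eq_def M' M'', ← Matrix.mul_assoc, transition_mul_transpose]
  rfl

variable (K : Type*) [Field K]

/-- The disjoint union of the affine charts. -/
abbrev ChartPoint (F : RegularFan n) : Type _ := MaxCone F × (Fin n → K)

variable {K}

/-- The gluing relation: the change of charts is biregular at the first point (it is regular
there and its inverse is regular at the image) and maps it to the second one. -/
def Glue {F : RegularFan n} (p q : ChartPoint K F) : Prop :=
  RegularAt (transition p.1.1 q.1.1) p.2 ∧
  RegularAt (transition q.1.1 p.1.1) (monomialMap (transition p.1.1 q.1.1) p.2) ∧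
  monomialMap (transition p.1.1 q.1.1) p.2 = q.2

theorem glue_refl {F : RegularFan n} (p : ChartPoint K F) : Glue p p := by
  have h : ∀ x : Fin n → K, RegularAt (1 : Matrix (Fin n) (Fin n) ℤ) x := fun x =>
    regularAt_of_nonneg (fun i j => by by_cases hij : i = j <;> simp [Matrix.one_apply, hij]) x
  refine ⟨?_, ?_, ?_⟩ <;> rw [transition_self]
  · exact h _
  · exact h _
  · exact monomialMap_one _

theorem glue_symm {F : RegularFan n} {p q : ChartPoint K F} (h : Glue p q) : Glue q p := by
  obtain ⟨h1, h2, h3⟩ := h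
  have h4 : monomialMap (transition q.1.1 p.1.1) q.2 = p.2 := by
    rw [← h3, monomialMap_mul h1 h2, transition_mul, transition_self, monomialMap_one]
  rw [h3] at h2
  exact ⟨h2, by rw [h4]; exact h1, h4⟩

theorem glue_trans {F : RegularFan n} {p q r : ChartPoint K F} (h : Glue p q) (h' : Glue q r) :
    Glue p r := by
  have aux : ∀ {p q r : ChartPoint K F}, Glue p q → Glue q r →
      RegularAt (transition p.1.1 r.1.1) p.2 ∧
        monomialMap (transition p.1.1 r.1.1) p.2 = r.2 := by
    rintro p q r ⟨h1, -, h3⟩ ⟨k1, -, k3⟩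
    rw [← h3] at k1 k3
    refine ⟨?_, ?_⟩
    · rw [← transition_mul _ q.1.1]
      exact regularAt_mul h1 k1
    · rw [← transition_mul _ q.1.1, ← monomialMap_mul h1 k1, k3]
  obtain ⟨h1, h2⟩ := aux h h'
  obtain ⟨k1, -⟩ := aux (glue_symm h') (glue_symm h)
  exact ⟨h1, by rw [h2]; exact k1, h2⟩

/-- The gluing relation as an equivalence relation. -/
def glueSetoid (K : Type*) [Field K] (F : RegularFan n) : Setoid (ChartPoint K F) where
  r := Glue
  iseqv := ⟨glue_refl, glue_symm, glue_trans⟩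

/-- The (`K`-points of the) toric variety `X_Σ`. -/
def ToricVariety (K : Type*) [Field K] (F : RegularFan n) : Type _ :=
  Quotient (glueSetoid K F)

/-- The inclusion of the chart `U_σ`, `σ = Cone(M)`. -/
def chart (K : Type*) [Field K] {F : RegularFan n} (M : MaxCone F) (x : Fin n → K) :
    ToricVariety K F :=
  Quotient.mk (glueSetoid K F) (M, x)

theorem column_mem (M : GL (Fin n) ℤ) (j : Fin n) : column M j ∈ coneGen (column M) :=
  ⟨Pi.single j 1, fun i => by by_cases h : i = j <;> simp [h], by
    simp [Pi.single_apply]⟩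

theorem MaxCone.nonneg {F : RegularFan n} (M : MaxCone F) (i j : Fin n) :
    0 ≤ M.1.val i j := by
  have h := F.subset_orthant _ M.2 (column_mem M.1 j) i
  simp only [column, toReal] at h
  exact_mod_cast h

/-- The toric modification `π : X_Σ → Kⁿ`, given on the chart of `Cone(M)` by `φ_{Mᵗ}`. -/
def toricModification (F : RegularFan n) : ToricVariety K F → (Fin n → K) :=
  Quotient.lift (fun p : ChartPoint K F => monomialMap p.1.1.valᵀ p.2) (by
    rintro p q ⟨h1, -, h3⟩
    have hq : RegularAt q.1.1.valᵀ (monomialMap (transition p.1.1 q.1.1) p.2) :=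
      regularAt_of_nonneg (fun i j => q.1.nonneg j i) _
    change monomialMap p.1.1.valᵀ p.2 = monomialMap q.1.1.valᵀ q.2
    rw [← h3, monomialMap_mul h1 hq, transition_mul_transpose])

/-- Zariski closed subsets of `X_Σ`: the trace on each affine chart is an algebraic set. -/
def IsZariskiClosed {F : RegularFan n} (Z : Set (ToricVariety K F)) : Prop :=
  ∀ M : MaxCone F, ∃ S : Set (MvPolynomial (Fin n) K),
    chart K M ⁻¹' Z = {x | ∀ p ∈ S, MvPolynomial.eval x p = 0}

/-- The Zariski closure in `X_Σ`. -/
def zariskiClosure {F : RegularFan n} (A : Set (ToricVariety K F)) : Set (ToricVariety K F) :=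
  ⋂₀ {Z | IsZariskiClosed Z ∧ A ⊆ Z}

/-- The strict transform of `V ⊆ Kⁿ`: the Zariski closure of the preimage of the set of points
of `V` outside the coordinate hyperplanes. -/
def strictTransform (F : RegularFan n) (V : Set (Fin n → K)) : Set (ToricVariety K F) :=
  zariskiClosure (toricModification F ⁻¹' {x ∈ V | ∀ i, x i ≠ 0})

/-- The orbit of a cone `τ`: if `τ` is generated by the columns of `M` with index in `s`, where
`Cone(M)` is in the fan, it consists of the points of the chart of `Cone(M)` whose vanishing
coordinates are exactly those with index in `s`. -/
def orbit (K : Type*) [Field K] (F : RegularFan n) (τ : Set (Fin n → ℝ)) :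
    Set (ToricVariety K F) :=
  {y | ∃ (M : MaxCone F) (s : Finset (Fin n)) (x : Fin n → K),
    τ = coneGen (fun j : s => column M.1 j) ∧ (∀ i, x i = 0 ↔ i ∈ s) ∧ y = chart K M x}

end Toric

end ToricTropical

end

/-!
In the chart of a maximal cone `Cone(M)` the strict transform of `V(I)` is the zero set of an ideal
`J`, and since the substitution `φ_{Mᵗ}` takes leading monomials to leading monomials, a weight `c`
lies in `TV(J)` exactly when `∑ cᵢ M_i` lies in `TV(I)`. A zero `x` of `J` is the centre of a
valuation that kills `J` but no coordinate and is trivial off the maximal ideal of `x`; embedding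
the relevant part of its value group into `ℝ` gives a real weight, positive exactly at the vanishing
coordinates of `x`, for which no element of `J` has a single term of minimal weight, as such an
element would have nonzero value. Conversely, if `J` has no zero on the stratum, the Nullstellensatz
gives an element of `J` with a single term of minimal weight, for every weight positive exactly at
the coordinates that vanish there. Hence the strict transform meets `O(τ)` if and only if the
relative interior of `τ` meets `TV(I)`, and membership in `TV(I)` is constant on the relative
interiors of the cones of a refinement of the Gröbner fan.
-/

noncomputable section

namespace ToricTropical

open MvPolynomial

/-! ### Initial ideals -/

section Initial

variable {n : ℕ}

theorem weight_add (ω : Fin n → ℝ) (μ ν : Fin n →₀ ℕ) :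
    weight ω (μ + ν) = weight ω μ + weight ω ν := by
  simp [weight, mul_add, Finset.sum_add_distrib]

theorem continuous_weight (μ : Fin n →₀ ℕ) : Continuous fun ω : Fin n → ℝ => weight ω μ := by
  unfold weight
  fun_prop

/-- `μ` is the only exponent of `f` of minimal `ω`-weight: for a weight `ω` without ties, this is
the notion of leading monomial of the theory of Gröbner bases. -/
def HasLeadingMonomial {R : Type*} [CommSemiring R] (ω : Fin n → ℝ) (f : MvPolynomial (Fin n) R)
    (μ : Fin n →₀ ℕ) : Prop :=
  f.coeff μ ≠ 0 ∧ ∀ ν ∈ f.support, ν ≠ μ → weight ω μ < weight ω ν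

namespace HasLeadingMonomial

variable {R : Type*} [CommSemiring R] {ω : Fin n → ℝ} {f g : MvPolynomial (Fin n) R}
  {μ ν : Fin n →₀ ℕ}

theorem le (h : HasLeadingMonomial ω f μ) (hν : ν ∈ f.support) : weight ω μ ≤ weight ω ν := by
  by_cases hne : ν = μ
  · rw [hne]
  · exact (h.2 ν hν hne).le

theorem of_monomial (ω : Fin n → ℝ) (μ : Fin n →₀ ℕ) {c : R} (hc : c ≠ 0) :
    HasLeadingMonomial ω (monomial μ c) μ :=
  ⟨by simpa using hc, fun _ hν hne => absurd (Finset.mem_singleton.mp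
    (support_monomial_subset hν)) hne⟩

theorem mul [NoZeroDivisors R] (hf : HasLeadingMonomial ω f μ) (hg : HasLeadingMonomial ω g ν) :
    HasLeadingMonomial ω (f * g) (μ + ν) := by
  classical
  have lt_of_ne : ∀ a ∈ f.support, ∀ b ∈ g.support, (a, b) ≠ (μ, ν) →
      weight ω (μ + ν) < weight ω (a + b) := by
    intro a ha b hb hne
    rw [weight_add, weight_add]
    by_cases h : a = μ
    · exact add_lt_add_of_le_of_lt (hf.le ha) (hg.2 b hb fun hb' => hne (by rw [h, hb']))
    · exact add_lt_add_of_lt_of_le (hf.2 a ha h) (hg.le hb)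
  constructor
  · rw [coeff_mul, Finset.sum_eq_single (μ, ν)]
    · exact mul_ne_zero hf.1 hg.1
    · rintro ⟨a, b⟩ hab hne
      by_contra h0
      have hlt := lt_of_ne a (mem_support_iff.mpr (left_ne_zero_of_mul h0)) b
        (mem_support_iff.mpr (right_ne_zero_of_mul h0)) hne
      exact hlt.ne' (congrArg (weight ω) (Finset.HasAntidiagonal.mem_antidiagonal.mp hab))
    · simp
  · intro ξ hξ hne
    obtain ⟨a, ha, b, hb, rfl⟩ := Finset.mem_add.mp (support_mul f g hξ)
    exact lt_of_ne a ha b hb fun h => hne (by rw [(Prod.mk.inj h).1, (Prod.mk.inj h).2])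

theorem pow [NoZeroDivisors R] [Nontrivial R] (hf : HasLeadingMonomial ω f μ) (k : ℕ) :
    HasLeadingMonomial ω (f ^ k) (k • μ) := by
  induction k with
  | zero => simpa using of_monomial ω (0 : Fin n →₀ ℕ) (one_ne_zero (α := R))
  | succ k ih => rw [pow_succ, succ_nsmul]; exact ih.mul hf

theorem eventually (h : HasLeadingMonomial ω f μ) : ∀ᶠ u in nhds ω, HasLeadingMonomial u f μ := by
  have hlt : ∀ ν ∈ f.support, ∀ᶠ u in nhds ω, ν ≠ μ → weight u μ < weight u ν := by
    intro ν hν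
    by_cases hne : ν = μ
    · simp [hne]
    · filter_upwards [(continuous_weight μ).continuousAt.eventually_lt
        (continuous_weight ν).continuousAt (h.2 ν hν hne)] with u hu _ using hu
  filter_upwards [(Filter.eventually_all_finset _).mpr hlt] with u hu using ⟨h.1, hu⟩

end HasLeadingMonomial

/-- `f` has no term of `ω`-weight less than `t`, and its terms of weight `t` are those of `g`. -/
def LiftsComponent {R : Type*} [CommSemiring R] (ω : Fin n → ℝ) (t : ℝ)
    (f g : MvPolynomial (Fin n) R) : Prop :=
  ∀ ν, weight ω ν ≤ t → f.coeff ν = if weight ω ν = t then g.coeff ν else 0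

namespace LiftsComponent

variable {R : Type*} [CommSemiring R] {ω : Fin n → ℝ} {t : ℝ} {f f' g g' : MvPolynomial (Fin n) R}

theorem add (h : LiftsComponent ω t f g) (h' : LiftsComponent ω t f' g') :
    LiftsComponent ω t (f + f') (g + g') := by
  intro ν hν
  rw [coeff_add, h ν hν, h' ν hν, coeff_add, ← ite_add_zero]

theorem monomial_mul {ξ : Fin n →₀ ℕ} (h : LiftsComponent ω (t - weight ω ξ) f g) (c : R) :
    LiftsComponent ω t (monomial ξ c * f) (monomial ξ c * g) := by
  intro ν hν
  rw [coeff_monomial_mul', coeff_monomial_mul']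
  by_cases hle : ξ ≤ ν
  · have hw : weight ω (ν - ξ) = weight ω ν - weight ω ξ := by
      rw [eq_sub_iff_add_eq, ← weight_add, tsub_add_cancel_of_le hle]
    simp only [if_pos hle, h _ (hw.trans_le (sub_le_sub_right hν _)), hw, sub_left_inj, mul_ite,
      mul_zero]
  · simp [hle]

end LiftsComponent

variable {K : Type*} [Field K] {ω : Fin n → ℝ}

open Classical in
theorem coeff_initialForm (ω : Fin n → ℝ) (f : MvPolynomial (Fin n) K) (ν : Fin n →₀ ℕ) :
    (initialForm ω f).coeff ν =
      if ∀ μ ∈ f.support, weight ω ν ≤ weight ω μ then f.coeff ν else 0 := by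
  rw [initialForm, coeff_sum]
  simp only [coeff_monomial, Finset.sum_ite_eq', Finset.mem_filter, mem_support_iff]
  by_cases hν : f.coeff ν = 0 <;> simp [hν]

theorem HasLeadingMonomial.initialForm_eq {f : MvPolynomial (Fin n) K} {μ : Fin n →₀ ℕ}
    (hf : HasLeadingMonomial ω f μ) : initialForm ω f = monomial μ (f.coeff μ) := by
  classical
  have hμ : μ ∈ f.support := mem_support_iff.mpr hf.1
  ext ν
  rw [coeff_initialForm, coeff_monomial]
  by_cases hνμ : μ = ν
  · subst hνμ
    rw [if_pos rfl, if_pos fun _ => hf.le]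
  · rw [if_neg hνμ, ite_eq_right_iff]
    intro hmin
    by_contra hν
    exact (hf.2 ν (mem_support_iff.mpr hν) (Ne.symm hνμ)).not_ge (hmin μ hμ)

theorem exists_liftsComponent_initialForm {I : Ideal (MvPolynomial (Fin n) K)}
    {f : MvPolynomial (Fin n) K} (hf : f ∈ I) (t : ℝ) :
    ∃ f' ∈ I, LiftsComponent ω t f' (initialForm ω f) := by
  by_cases h : ∀ ν, weight ω ν = t → (initialForm ω f).coeff ν = 0
  · exact ⟨0, I.zero_mem, fun ν _ => by rw [coeff_zero, eq_comm, ite_eq_right_iff]; exact h ν⟩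
  · push Not at h
    obtain ⟨μ, rfl, hμ⟩ := h
    have hmin : ∀ ν ∈ f.support, weight ω μ ≤ weight ω ν := by
      by_contra hmin
      exact hμ (by rw [coeff_initialForm, if_neg hmin])
    refine ⟨f, hf, fun ν hν => ?_⟩
    split_ifs with heq
    · rw [coeff_initialForm, if_pos (heq ▸ hmin)]
    · by_contra hne
      exact heq (hν.antisymm (hmin ν (mem_support_iff.mpr hne)))

theorem exists_liftsComponent_of_mem_initialIdeal {I : Ideal (MvPolynomial (Fin n) K)}
    {g : MvPolynomial (Fin n) K} (hg : g ∈ initialIdeal ω I) (t : ℝ) :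
    ∃ f ∈ I, LiftsComponent ω t f g := by
  induction hg using Submodule.span_induction generalizing t with
  | mem g hg =>
    obtain ⟨f, hf, rfl⟩ := hg
    exact exists_liftsComponent_initialForm hf t
  | zero => exact ⟨0, I.zero_mem, fun ν _ => by simp⟩
  | add g g' _ _ ih ih' =>
    obtain ⟨f, hf, h⟩ := ih t
    obtain ⟨f', hf', h'⟩ := ih' t
    exact ⟨f + f', I.add_mem hf hf', h.add h'⟩
  | smul a g _ ih =>
    rw [smul_eq_mul]
    induction a using MvPolynomial.induction_on' generalizing t with
    | monomial ξ c =>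
      obtain ⟨f, hf, h⟩ := ih (t - weight ω ξ)
      exact ⟨monomial ξ c * f, I.mul_mem_left _ hf, h.monomial_mul c⟩
    | add a b iha ihb =>
      obtain ⟨f, hf, h⟩ := iha t
      obtain ⟨f', hf', h'⟩ := ihb t
      exact ⟨f + f', I.add_mem hf hf', by rw [add_mul]; exact h.add h'⟩

theorem notMem_tropicalVariety_iff {I : Ideal (MvPolynomial (Fin n) K)} :
    ω ∉ tropicalVariety I ↔ ∃ f ∈ I, ∃ μ, HasLeadingMonomial ω f μ := by
  simp only [tropicalVariety, Set.mem_ofPred_eq, not_forall, not_not]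
  constructor
  · rintro ⟨μ, hμ⟩
    obtain ⟨f, hf, h⟩ := exists_liftsComponent_of_mem_initialIdeal hμ (weight ω μ)
    refine ⟨f, hf, μ, by simp [h μ le_rfl], fun ν hν hne => lt_of_not_ge fun hle => ?_⟩
    exact mem_support_iff.mp hν (by simp [h ν hle, coeff_monomial, hne.symm])
  · rintro ⟨f, hf, μ, h⟩
    have hmem : monomial μ (f.coeff μ) ∈ initialIdeal ω I := by
      rw [← h.initialForm_eq]
      exact Ideal.subset_span ⟨f, hf, rfl⟩
    refine ⟨μ, ?_⟩
    simpa only [C_mul_monomial, inv_mul_cancel₀ h.1] using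
      (initialIdeal ω I).mul_mem_left (C (f.coeff μ)⁻¹) hmem

theorem isClosed_tropicalVariety (I : Ideal (MvPolynomial (Fin n) K)) :
    IsClosed (tropicalVariety I) := by
  rw [← isOpen_compl_iff, isOpen_iff_mem_nhds]
  intro ω hω
  obtain ⟨f, hf, μ, h⟩ := notMem_tropicalVariety_iff.mp hω
  filter_upwards [h.eventually] with u hu using notMem_tropicalVariety_iff.mpr ⟨f, hf, μ, hu⟩

theorem groebnerCone_subset_tropicalVariety {I : Ideal (MvPolynomial (Fin n) K)}
    (hω : ω ∈ tropicalVariety I) : groebnerCone I ω ⊆ tropicalVariety I := by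
  refine closure_minimal (fun u hu μ => ?_) (isClosed_tropicalVariety I)
  rw [show initialIdeal u I = initialIdeal ω I from hu]
  exact hω μ

end Initial

/-! ### Cones and fans -/

section Cones

variable {n : ℕ}

/-- The relative interior of a cone, described as the set of its points that lie on no proper
face. -/
def relInterior (τ : Set (Fin n → ℝ)) : Set (Fin n → ℝ) :=
  {x ∈ τ | ∀ v ∈ dualCone τ, v ⬝ᵥ x = 0 → ∀ y ∈ τ, v ⬝ᵥ y = 0}

variable {ι : Type} [Fintype ι] {u : ι → Fin n → ℝ}

theorem mem_coneGen_self (u : ι → Fin n → ℝ) (i : ι) : u i ∈ coneGen u := by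
  classical
  exact ⟨Pi.single i 1, fun j => by by_cases h : j = i <;> simp [h], by simp [Pi.single_apply]⟩

theorem dotProduct_sum_smul (v : Fin n → ℝ) (c : ι → ℝ) (u : ι → Fin n → ℝ) :
    v ⬝ᵥ ∑ i, c i • u i = ∑ i, c i * (v ⬝ᵥ u i) := by
  simp only [dotProduct_sum, dotProduct_smul, smul_eq_mul]

theorem dotProduct_sum_smul_eq_zero_iff {v : Fin n → ℝ} (hv : v ∈ dualCone (coneGen u))
    {c : ι → ℝ} (hc : ∀ i, 0 ≤ c i) :
    v ⬝ᵥ ∑ i, c i • u i = 0 ↔ ∀ i, c i = 0 ∨ v ⬝ᵥ u i = 0 := by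
  rw [dotProduct_sum_smul, Finset.sum_eq_zero_iff_of_nonneg fun i _ =>
    mul_nonneg (hc i) (hv _ (mem_coneGen_self u i))]
  simp only [Finset.mem_univ, forall_const, mul_eq_zero]

theorem sum_smul_mem_relInterior {c : ι → ℝ} (hc : ∀ i, 0 < c i) :
    ∑ i, c i • u i ∈ relInterior (coneGen u) := by
  refine ⟨⟨c, fun i => (hc i).le, rfl⟩, fun v hv h0 y hy => ?_⟩
  have hvu i : v ⬝ᵥ u i = 0 :=
    ((dotProduct_sum_smul_eq_zero_iff hv fun i => (hc i).le).mp h0 i).resolve_left (hc i).ne'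
  obtain ⟨d, hd, rfl⟩ := hy
  exact (dotProduct_sum_smul_eq_zero_iff hv hd).mpr fun i => Or.inr (hvu i)

theorem mem_relInterior_coneGen_iff (hu : LinearIndependent ℝ u) {x : Fin n → ℝ} :
    x ∈ relInterior (coneGen u) ↔ ∃ c : ι → ℝ, (∀ i, 0 < c i) ∧ x = ∑ i, c i • u i := by
  classical
  refine ⟨?_, fun ⟨c, hc, hx⟩ => hx ▸ sum_smul_mem_relInterior hc⟩
  rintro ⟨⟨c, hc, rfl⟩, hint⟩
  refine ⟨c, fun i => (hc i).lt_of_ne' fun hci => ?_, rfl⟩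
  -- The functional dual to `u i` supports the cone along the face opposite to `u i`.
  obtain ⟨f, hf⟩ := LinearMap.exists_extend ((Module.Basis.span hu).coord i)
  obtain ⟨v, rfl⟩ := (dotProductEquiv ℝ (Fin n)).surjective f
  have hvu j : v ⬝ᵥ u j = if j = i then 1 else 0 := by
    simpa [Finsupp.single_apply] using LinearMap.congr_fun hf (Module.Basis.span hu j)
  have hdual : v ∈ dualCone (coneGen u) := by
    rintro y ⟨d, hd, rfl⟩
    simpa [dotProduct_sum_smul, hvu] using hd i
  have hone := hint v hdual (by simp [dotProduct_sum_smul, hvu, hci]) _ (mem_coneGen_self u i)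
  simp [hvu] at hone

theorem exists_subtype_sum_smul_iff {s : Finset ι} {p : ℝ → Prop} {x : Fin n → ℝ} :
    (∃ c : s → ℝ, (∀ i, p (c i)) ∧ x = ∑ i, c i • u i) ↔
      ∃ c : ι → ℝ, (∀ i ∈ s, p (c i)) ∧ (∀ i ∉ s, c i = 0) ∧ x = ∑ i, c i • u i := by
  classical
  constructor
  · rintro ⟨c, hc, rfl⟩
    refine ⟨fun i => if h : i ∈ s then c ⟨i, h⟩ else 0, fun i hi => by simpa [hi] using hc ⟨i, hi⟩,
      fun i hi => dif_neg hi, ?_⟩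
    rw [← Finset.sum_subset s.subset_univ fun i _ hi => by simp [hi], ← Finset.sum_coe_sort s]
    simp
  · rintro ⟨c, hc, hcs, rfl⟩
    refine ⟨fun i => c i, fun i => hc i i.2, ?_⟩
    rw [Finset.sum_coe_sort s fun i => c i • u i]
    exact (Finset.sum_subset s.subset_univ fun i _ hi => by simp [hcs i hi]).symm

theorem IsFace.exists_eq_coneGen {τ : Set (Fin n → ℝ)} (h : IsFace τ (coneGen u)) :
    ∃ s : Finset ι, τ = coneGen (fun j : s => u j) := by
  classical
  obtain ⟨v, hv, rfl⟩ := h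
  refine ⟨Finset.univ.filter fun i => v ⬝ᵥ u i = 0, Set.ext fun x => ?_⟩
  simp only [coneGen, Set.mem_ofPred_eq, exists_subtype_sum_smul_iff, Finset.mem_filter,
    Finset.mem_univ, true_and]
  constructor
  · rintro ⟨⟨c, hc, rfl⟩, h0⟩
    have := (dotProduct_sum_smul_eq_zero_iff hv hc).mp h0
    exact ⟨c, fun i _ => hc i, fun i hi => (this i).resolve_right hi, rfl⟩
  · rintro ⟨c, hc, hcs, rfl⟩
    have hc' i : 0 ≤ c i := by
      by_cases hi : v ⬝ᵥ u i = 0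
      · exact hc i hi
      · exact (hcs i hi).ge
    exact ⟨⟨c, hc', rfl⟩, (dotProduct_sum_smul_eq_zero_iff hv hc').mpr fun i =>
      or_iff_not_imp_right.mpr (hcs i)⟩

theorem isClosed_coneGen_basis (b : Module.Basis ι ℝ (Fin n → ℝ)) : IsClosed (coneGen b) := by
  have : coneGen b = ⋂ j, {x | 0 ≤ b.coord j x} := by
    ext x
    simp only [Set.mem_iInter]
    constructor
    · rintro ⟨c, hc, rfl⟩ j
      rw [Set.mem_ofPred_eq, Module.Basis.coord_apply, b.repr_sum_self]
      exact hc j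
    · exact fun h => ⟨_, h, (b.sum_repr x).symm⟩
  rw [this]
  exact isClosed_iInter fun j =>
    isClosed_le continuous_const (b.coord j).continuous_of_finiteDimensional

theorem linearIndependent_column (M : GL (Fin n) ℤ) : LinearIndependent ℝ (column M) :=
  Matrix.linearIndependent_cols_of_isUnit
    (Matrix.GeneralLinearGroup.map (Int.castRingHom ℝ) M).isUnit

theorem isClosed_coneGen_column (M : GL (Fin n) ℤ) : IsClosed (coneGen (column M)) := by
  have hspan := (linearIndependent_column M).span_eq_top_of_card_eq_finrank' (by simp)
  simpa only [Module.Basis.coe_mk] using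
    isClosed_coneGen_basis (Module.Basis.mk (linearIndependent_column M) hspan.ge)

theorem IsRegularCone.exists_eq_coneGen_column {σ : Set (Fin n → ℝ)} (h : IsRegularCone σ)
    (htop : Submodule.span ℝ σ = ⊤) : ∃ M : GL (Fin n) ℤ, σ = coneGen (column M) := by
  obtain ⟨k, u, hσ, hli, hspan⟩ := h
  have hsp : ⊤ ≤ Submodule.span ℤ (Set.range u) := fun v _ =>
    (hspan v).mp (by rw [htop]; exact Submodule.mem_top)
  let b := Module.Basis.mk hli hsp
  obtain rfl : k = n := by
    simpa using Fintype.card_congr (b.indexEquiv (Pi.basisFun ℤ (Fin n)))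
  refine ⟨⟨(Pi.basisFun ℤ (Fin k)).toMatrix b, b.toMatrix (Pi.basisFun ℤ (Fin k)),
    (Pi.basisFun ℤ (Fin k)).toMatrix_mul_toMatrix_flip b,
    b.toMatrix_mul_toMatrix_flip (Pi.basisFun ℤ (Fin k))⟩, ?_⟩
  have hcol j : toReal (u j) = toReal fun i => (Pi.basisFun ℤ (Fin k)).toMatrix b i j := by
    simp [Module.Basis.toMatrix_apply, b]
  exact hσ.trans (congrArg coneGen (funext hcol))

theorem mem_relInterior_coneGen_column_iff {M : GL (Fin n) ℤ} {s : Finset (Fin n)}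
    {x : Fin n → ℝ} : x ∈ relInterior (coneGen fun j : s => column M j) ↔
      ∃ c : Fin n → ℝ, (∀ i ∈ s, 0 < c i) ∧ (∀ i ∉ s, c i = 0) ∧ x = ∑ i, c i • column M i := by
  rw [← exists_subtype_sum_smul_iff]
  exact mem_relInterior_coneGen_iff
    ((linearIndependent_column M).comp _ Subtype.val_injective)

theorem coordCone_univ : coordCone (Finset.univ : Finset (Fin n)) = orthant n := by
  ext x
  rw [coordCone, coneGen, Set.mem_ofPred_eq,
    exists_subtype_sum_smul_iff (u := fun i => (Pi.single i 1 : Fin n → ℝ))]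
  constructor
  · rintro ⟨c, hc, -, rfl⟩ i
    rw [← pi_eq_sum_univ' c]
    exact hc i (Finset.mem_univ i)
  · exact fun hx => ⟨x, fun i _ => hx i, by simp, pi_eq_sum_univ' x⟩

theorem orthant_subset_closure :
    orthant n ⊆ closure (Set.univ.pi fun _ : Fin n => Set.Ioi (0 : ℝ)) := by
  intro x hx
  rw [closure_pi_set]
  intro i _
  rw [closure_Ioi]
  exact hx i

theorem dense_setOf_forall_mem_span_eq_top {S : Set (Set (Fin n → ℝ))} (hS : S.Finite) :
    Dense {x | ∀ σ ∈ S, x ∈ σ → Submodule.span ℝ σ = ⊤} := by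
  refine MeasureTheory.Measure.dense_of_ae (μ := MeasureTheory.volume)
    ((MeasureTheory.ae_ball_iff hS.countable).mpr fun σ _ => ?_)
  by_cases htop : Submodule.span ℝ σ = ⊤
  · exact Filter.Eventually.of_forall fun _ _ => htop
  · filter_upwards [MeasureTheory.measure_eq_zero_iff_ae_notMem.mp
      (MeasureTheory.Measure.addHaar_submodule MeasureTheory.volume _ htop)] with x hx hxσ
    exact absurd (Submodule.subset_span hxσ) hx

end Cones

section Fans

variable {n : ℕ} {F : RegularFan n}

theorem RegularFan.relInterior_nonempty {τ : Set (Fin n → ℝ)} (hτ : τ ∈ F.cones) :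
    (relInterior τ).Nonempty := by
  obtain ⟨k, u, rfl, -, -⟩ := F.regular τ hτ
  exact ⟨_, sum_smul_mem_relInterior (c := 1) fun _ => one_pos⟩

theorem RegularFan.subset_of_mem_relInterior {σ τ : Set (Fin n → ℝ)} (hσ : σ ∈ F.cones)
    (hτ : τ ∈ F.cones) {w : Fin n → ℝ} (hw : w ∈ σ) (hwτ : w ∈ relInterior τ) : τ ⊆ σ := by
  obtain ⟨v, hv, heq⟩ := (F.inter_face σ hσ τ hτ).2
  have hvw : v ⬝ᵥ w = 0 := (heq.subset ⟨hw, hwτ.1⟩).2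
  exact fun y hy => (heq.superset ⟨hy, hwτ.2 v hv hvw y hy⟩).1

theorem RegularFan.exists_maxCone_mem (hF : orthant n ⊆ ⋃₀ F.cones) {x : Fin n → ℝ}
    (hx : x ∈ orthant n) : ∃ M : MaxCone F, x ∈ coneGen (column M.1) := by
  let T : Set (Set (Fin n → ℝ)) := {σ ∈ F.cones | Submodule.span ℝ σ = ⊤}
  have exists_column : ∀ σ ∈ T, ∃ M : GL (Fin n) ℤ, σ = coneGen (column M) :=
    fun σ hσ => (F.regular σ hσ.1).exists_eq_coneGen_column hσ.2
  have hclosed : IsClosed (⋃₀ T) := by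
    rw [Set.sUnion_eq_biUnion]
    refine (F.finite.subset (Set.sep_subset _ _)).isClosed_biUnion fun σ hσ => ?_
    obtain ⟨M, rfl⟩ := exists_column σ hσ
    exact isClosed_coneGen_column M
  have hopen : IsOpen (Set.univ.pi fun _ : Fin n => Set.Ioi (0 : ℝ)) :=
    isOpen_set_pi Set.finite_univ fun _ _ => isOpen_Ioi
  have hsub : closure (Set.univ.pi fun _ : Fin n => Set.Ioi (0 : ℝ)) ⊆ ⋃₀ T := by
    refine closure_minimal (((dense_setOf_forall_mem_span_eq_top
      F.finite).open_subset_closure_inter hopen).trans (closure_minimal ?_ hclosed)) hclosed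
    rintro y ⟨hy, hytop⟩
    obtain ⟨σ, hσ, hyσ⟩ := hF fun i => (hy i (Set.mem_univ i)).le
    exact ⟨σ, ⟨hσ, hytop σ hσ hyσ⟩, hyσ⟩
  obtain ⟨σ, hσ, hxσ⟩ := hsub (orthant_subset_closure hx)
  obtain ⟨M, rfl⟩ := exists_column σ hσ
  exact ⟨⟨M, hσ.1⟩, hxσ⟩

theorem RegularFan.exists_eq_coneGen_column (hF : orthant n ⊆ ⋃₀ F.cones)
    {τ : Set (Fin n → ℝ)} (hτ : τ ∈ F.cones) :
    ∃ (M : MaxCone F) (s : Finset (Fin n)), τ = coneGen (fun j : s => column M.1 j) := by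
  obtain ⟨w, hw⟩ := F.relInterior_nonempty hτ
  obtain ⟨M, hM⟩ := exists_maxCone_mem hF (F.subset_orthant τ hτ hw.1)
  have hface := (F.inter_face _ M.2 τ hτ).1
  rw [Set.inter_eq_right.mpr (F.subset_of_mem_relInterior M.2 hτ hM hw)] at hface
  exact ⟨M, hface.exists_eq_coneGen⟩

variable {K : Type*} [Field K] {I : Ideal (MvPolynomial (Fin n) K)}

theorem IsRefinement.exists_mem_subset_groebnerCone {S : Set (Set (Fin n → ℝ))}
    (hS : IsRefinement S (groebnerFan I)) {w : Fin n → ℝ} (hw : w ∈ orthant n) :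
    ∃ σ ∈ S, w ∈ σ ∧ σ ⊆ groebnerCone I w := by
  obtain ⟨S', hS', heq⟩ := hS _ ⟨w, Finset.univ, rfl⟩
  obtain ⟨σ, hσ, hwσ⟩ := heq.subset ⟨subset_closure rfl, coordCone_univ.superset hw⟩
  exact ⟨σ, hS' hσ, hwσ, fun y hy => (heq.superset ⟨σ, hσ, hy⟩).1⟩

theorem IsRefinement.orthant_subset_sUnion {S : Set (Set (Fin n → ℝ))}
    (hS : IsRefinement S (groebnerFan I)) : orthant n ⊆ ⋃₀ S := fun _ hw =>
  let ⟨σ, hσ, hwσ, _⟩ := hS.exists_mem_subset_groebnerCone hw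
  ⟨σ, hσ, hwσ⟩

theorem relInterior_inter_tropicalVariety_nonempty_iff
    (hF : IsRefinement F.cones (groebnerFan I)) {τ : Set (Fin n → ℝ)} (hτ : τ ∈ F.cones) :
    (relInterior τ ∩ tropicalVariety I).Nonempty ↔ τ ⊆ tropicalVariety I := by
  constructor
  · rintro ⟨w, hw, hwI⟩
    obtain ⟨σ, hσ, hwσ, hsub⟩ :=
      hF.exists_mem_subset_groebnerCone (F.subset_orthant τ hτ hw.1)
    calc τ ⊆ σ := F.subset_of_mem_relInterior hσ hτ hwσ hw
      _ ⊆ groebnerCone I w := hsub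
      _ ⊆ tropicalVariety I := groebnerCone_subset_tropicalVariety hwI
  · intro h
    obtain ⟨w, hw⟩ := F.relInterior_nonempty hτ
    exact ⟨w, hw, h hw.1⟩

end Fans

/-! ### Valuations centred at a prime ideal -/

section Valuation

theorem exists_valuation_of_isLocalRing.{u} {D : Type u} [CommRing D] [IsDomain D]
    [IsLocalRing D] : ∃ (Γ : Type u) (_ : LinearOrderedCommGroupWithZero Γ) (v : Valuation D Γ),
      (∀ a, v a ≤ 1) ∧ (∀ a, v a < 1 ↔ a ∈ IsLocalRing.maximalIdeal D) ∧
        ∀ a, v a = 0 ↔ a = 0 := by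
  obtain ⟨B, hB, hloc⟩ :=
    IsLocalRing.exists_factor_valuationRing (algebraMap D (FractionRing D))
  refine ⟨B.ValueGroup, inferInstance, B.valuation.comap (algebraMap D (FractionRing D)),
    fun a => (B.valuation_le_one_iff _).mpr (hB a), fun a => ?_, fun a => ?_⟩
  · let f : D →+* B := (algebraMap D (FractionRing D)).codRestrict B.toSubring hB
    have : IsLocalHom f := hloc
    rw [← IsLocalRing.maximalIdeal_comap f, Ideal.mem_comap, B.valuation_lt_one_iff]
    rfl
  · rw [Valuation.comap_apply, map_eq_zero]
    exact map_eq_zero_iff _ (IsFractionRing.injective D (FractionRing D))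

variable {D : Type*} [CommRing D] [IsDomain D] [IsNoetherianRing D]

theorem eq_bot_of_lt_of_mem_minimalPrimes_span_singleton {a : D} {P Q : Ideal D} [P.IsPrime]
    (hQ : Q ∈ (Ideal.span {a}).minimalPrimes) (hlt : P < Q) : P = ⊥ := by
  have := hQ.1.1
  have hQ1 : Q.height ≤ ((1 : ℕ) : ℕ∞) :=
    Ideal.height_le_one_of_isPrincipal_of_mem_minimalPrimes (Ideal.span {a}) Q hQ
  have hP0 : P.height = 0 := by
    simpa [Order.lt_one_iff] using Ideal.height_le_iff.mp hQ1 P inferInstance hlt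
  rwa [Ideal.height_eq_zero_iff, IsDomain.minimalPrimes_eq_singleton_bot] at hP0

theorem dimensionLEOne_of_forall_isPrime_mem {h : D} (h0 : h ≠ 0)
    (hh : ∀ P : Ideal D, P.IsPrime → P ≠ ⊥ → h ∈ P) : Ring.DimensionLEOne D := by
  refine ⟨fun {P} hP hPp => ?_⟩
  obtain ⟨m, hm, hPm⟩ := P.exists_le_maximal hPp.ne_top
  rcases hPm.eq_or_lt with rfl | hlt
  · exact hm
  have hfin := Ideal.finite_minimalPrimes_of_isNoetherianRing D (Ideal.span {h})
  have hspan : Ideal.span {h} ≤ m :=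
    (Ideal.span_singleton_le_iff_mem _).mpr (hPm (hh P hPp hP))
  -- By prime avoidance, some `a ∈ m` lies in no minimal prime of `h`; a minimal prime of `a` then
  -- contains `h`, which contradicts Krull's principal ideal theorem.
  obtain ⟨a, ham, ha⟩ : ∃ a ∈ m, ∀ Q ∈ (Ideal.span {h}).minimalPrimes, a ∉ Q := by
    by_contra! hcover
    obtain ⟨Q, hQ, hmQ⟩ := (Ideal.subset_union_prime (s := hfin.toFinset) (f := id) (I := m) ⊥ ⊥
      fun Q hQ _ _ => (hfin.mem_toFinset.mp hQ).1.1).mp fun a ha => by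
        simpa using hcover a ha
    exact hP (eq_bot_of_lt_of_mem_minimalPrimes_span_singleton (hfin.mem_toFinset.mp hQ)
      (hlt.trans_le hmQ))
  obtain ⟨Q₀, hQ₀, -⟩ := Ideal.exists_minimalPrimes_le hspan
  have ha0 : a ≠ 0 := fun h0 => ha Q₀ hQ₀ (h0 ▸ Q₀.zero_mem)
  obtain ⟨P', hP', -⟩ := Ideal.exists_minimalPrimes_le
    ((Ideal.span_singleton_le_iff_mem _).mpr ham)
  have haP' : a ∈ P' := hP'.1.2 (Ideal.mem_span_singleton_self a)
  have hhP' : h ∈ P' := hh P' hP'.1.1 fun hbot => ha0 (by rwa [hbot, Ideal.mem_bot] at haP')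
  have := hP'.1.1
  obtain ⟨Q, hQ, hQP'⟩ := Ideal.exists_minimalPrimes_le
    ((Ideal.span_singleton_le_iff_mem _).mpr hhP')
  have := hQ.1.1
  have hQbot : Q = ⊥ := eq_bot_of_lt_of_mem_minimalPrimes_span_singleton hP'
    (hQP'.lt_of_ne fun heq => ha Q hQ (heq ▸ haP'))
  have hhQ : h ∈ Q := hQ.1.2 (Ideal.mem_span_singleton_self h)
  exact absurd (by rwa [hQbot, Ideal.mem_bot] at hhQ) h0

theorem exists_dvd_pow_of_forall_isPrime_mem [IsLocalRing D] {h : D} (h0 : h ≠ 0)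
    (hh : ∀ P : Ideal D, P.IsPrime → P ≠ ⊥ → h ∈ P) {y : D}
    (hy : y ∈ IsLocalRing.maximalIdeal D) : ∃ N : ℕ, h ∣ y ^ N := by
  have := dimensionLEOne_of_forall_isPrime_mem h0 hh
  have hrad : y ∈ (Ideal.span {h}).radical := by
    rw [Ideal.radical_eq_sInf, Submodule.mem_sInf]
    rintro P ⟨hle, hP⟩
    have hhP := (Ideal.span_singleton_le_iff_mem _).mp hle
    have hPbot : P ≠ ⊥ := fun hbot => h0 (by rwa [hbot, Ideal.mem_bot] at hhP)
    rwa [IsLocalRing.eq_maximalIdeal (hP.isMaximal hPbot)]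
  obtain ⟨N, hN⟩ := Ideal.mem_radical_iff.mp hrad
  exact ⟨N, Ideal.mem_span_singleton.mp hN⟩

theorem exists_isPrime_notMem_forall_lt_mem {R : Type*} [CommRing R] [IsNoetherianRing R]
    {J : Ideal R} {h : R} (hJ : h ∉ J.radical) :
    ∃ Q : Ideal R, Q.IsPrime ∧ J ≤ Q ∧ h ∉ Q ∧ ∀ P : Ideal R, P.IsPrime → Q < P → h ∈ P := by
  have hne : {Q : Ideal R | Q.IsPrime ∧ J ≤ Q ∧ h ∉ Q}.Nonempty := by
    rw [Ideal.radical_eq_sInf, Submodule.mem_sInf] at hJ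
    push Not at hJ
    obtain ⟨Q, ⟨hle, hQ⟩, hhQ⟩ := hJ
    exact ⟨Q, hQ, hle, hhQ⟩
  obtain ⟨Q, ⟨hQ, hJQ, hhQ⟩, hmax⟩ :=
    set_has_maximal_iff_noetherian.mpr (inferInstance : IsNoetherian R R) _ hne
  exact ⟨Q, hQ, hJQ, hhQ, fun P hP hlt => by_contra fun hhP =>
    hmax P ⟨hP, hJQ.trans hlt.le, hhP⟩ hlt⟩

theorem exists_valuation_of_isLocalRing_of_notMem_radical.{u} {R : Type u} [CommRing R]
    [IsNoetherianRing R] [IsLocalRing R] {J : Ideal R} {h : R} (hJ : h ∉ J.radical) :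
    ∃ (Γ : Type u) (_ : LinearOrderedCommGroupWithZero Γ) (v : Valuation R Γ),
      (∀ a, v a ≤ 1) ∧ (∀ a, v a < 1 ↔ a ∈ IsLocalRing.maximalIdeal R) ∧
        (∀ a ∈ J, v a = 0) ∧ v h ≠ 0 ∧ ∀ y, v y < 1 → ∃ N : ℕ, v y ^ N ≤ v h := by
  obtain ⟨Q, hQ, hJQ, hhQ, hmax⟩ := exists_isPrime_notMem_forall_lt_mem hJ
  let π := Ideal.Quotient.mk Q
  have hπ : Function.Surjective π := Ideal.Quotient.mk_surjective
  have : IsLocalRing (R ⧸ Q) := .of_surjective' π hπ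
  have : IsLocalHom π := .of_surjective π hπ
  have hh0 : π h ≠ 0 := fun h0 => hhQ (Ideal.Quotient.eq_zero_iff_mem.mp h0)
  have hmem : ∀ P : Ideal (R ⧸ Q), P.IsPrime → P ≠ ⊥ → π h ∈ P := by
    intro P hP hPbot
    have hlt : Q < P.comap π := by
      refine lt_of_le_of_ne (fun q hq => ?_) fun heq => hPbot ?_
      · rw [Ideal.mem_comap, Ideal.Quotient.eq_zero_iff_mem.mpr hq]
        exact P.zero_mem
      · rw [← Ideal.map_comap_of_surjective π hπ P, ← heq, Ideal.map_quotient_self]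
    exact hmax _ (Ideal.IsPrime.comap π) hlt
  obtain ⟨Γ, _, v, hv1, hvm, hv0⟩ := exists_valuation_of_isLocalRing (D := R ⧸ Q)
  refine ⟨Γ, inferInstance, v.comap π, fun a => hv1 _, fun a => ?_, fun a ha => ?_, ?_, ?_⟩
  · rw [Valuation.comap_apply, hvm, ← Ideal.mem_comap, IsLocalRing.maximalIdeal_comap π]
  · exact (hv0 _).mpr (Ideal.Quotient.eq_zero_iff_mem.mpr (hJQ ha))
  · exact (hv0 _).not.mpr hh0
  · intro y hy
    obtain ⟨N, c, hc⟩ := exists_dvd_pow_of_forall_isPrime_mem hh0 hmem ((hvm _).mp hy)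
    refine ⟨N, ?_⟩
    rw [Valuation.comap_apply, Valuation.comap_apply, ← map_pow, hc, map_mul]
    exact mul_le_of_le_one_right' (hv1 c)

theorem exists_valuation_of_forall_mul_pow_notMem.{u} {A : Type u} [CommRing A]
    [IsNoetherianRing A] {J m : Ideal A} [m.IsPrime] {h : A}
    (hJ : ∀ g ∉ m, ∀ N : ℕ, g * h ^ N ∉ J) :
    ∃ (Γ : Type u) (_ : LinearOrderedCommGroupWithZero Γ) (v : Valuation A Γ),
      (∀ a, v a ≤ 1) ∧ (∀ a, v a < 1 ↔ a ∈ m) ∧ (∀ a ∈ J, v a = 0) ∧ v h ≠ 0 ∧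
        ∀ y, v y < 1 → ∃ N : ℕ, v y ^ N ≤ v h := by
  let R := Localization.AtPrime m
  have hrad : algebraMap A R h ∉ (J.map (algebraMap A R)).radical := by
    rintro ⟨N, hN⟩
    rw [← map_pow, IsLocalization.algebraMap_mem_map_algebraMap_iff m.primeCompl] at hN
    obtain ⟨g, hg, hgN⟩ := hN
    exact hJ g hg N hgN
  obtain ⟨Γ, _, v, hv1, hvm, hvJ, hvh, hpow⟩ :=
    exists_valuation_of_isLocalRing_of_notMem_radical hrad
  refine ⟨Γ, inferInstance, v.comap (algebraMap A R), fun a => hv1 _, fun a => ?_,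
    fun a ha => hvJ _ (Ideal.mem_map_of_mem _ ha), hvh, fun y hy => hpow _ hy⟩
  rw [Valuation.comap_apply, hvm, IsLocalization.AtPrime.to_map_mem_maximal_iff R m]

end Valuation

/-! ### Real weights -/

section RealWeight

variable {G : Type*} [AddCommGroup G] [LinearOrder G] [IsOrderedAddMonoid G]

theorem exists_addMonoidHom_real_of_pos {h : G} (hh : 0 < h) :
    ∃ φ : G →+ ℝ, 0 < φ h ∧ ∀ g, 0 ≤ g → (∃ N : ℕ, g ≤ N • h) → 0 ≤ φ g := by
  obtain ⟨f, hf, hmk⟩ := hahnEmbedding_isOrderedAddMonoid G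
  let φ : G →+ ℝ :=
    { toFun g := (ofLex (f g)).coeff (FiniteArchimedeanClass.mk h hh.ne')
      map_zero' := by simp
      map_add' := by simp }
  have horder : ∀ g (hg : g ≠ 0), (ofLex (f g)).orderTop = FiniteArchimedeanClass.mk g hg :=
    fun g hg => by
      rw [← FiniteArchimedeanClass.withTopOrderIso_symm_apply hg, hmk, OrderIso.symm_apply_apply]
  have hcoeff : ∀ g, (ofLex (f g)).orderTop = FiniteArchimedeanClass.mk h hh.ne' →
      φ g = (ofLex (f g)).leadingCoeff := fun g hg => by
    rw [HahnSeries.leadingCoeff, hg, WithTop.recTopCoe_coe]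
    rfl
  refine ⟨φ, ?_, ?_⟩
  · rw [hcoeff h (horder h hh.ne'), HahnSeries.leadingCoeff_pos_iff]
    exact (map_nonneg f hh.le).lt_of_ne' ((map_ne_zero_iff f hf).mpr hh.ne')
  · rintro g hg ⟨N, hN⟩
    have hle : (FiniteArchimedeanClass.mk h hh.ne' : WithTop _) ≤ (ofLex (f g)).orderTop := by
      rw [← horder h hh.ne', ← (FiniteArchimedeanClass.withTopOrderIso G).le_iff_le, ← hmk, ← hmk,
        ArchimedeanClass.mk_le_mk]
      exact ⟨N, by rwa [abs_of_nonneg hg, abs_of_pos hh]⟩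
    rcases hle.eq_or_lt with heq | hlt
    · rw [hcoeff g heq.symm, HahnSeries.leadingCoeff_nonneg_iff]
      exact map_nonneg f hg
    · exact (HahnSeries.coeff_eq_zero_of_lt_orderTop hlt).ge

theorem exists_real_weight_of_nonneg {ι : Type*} [Fintype ι] {g : ι → G} (hg : ∀ i, 0 ≤ g i)
    (hbdd : ∀ i, 0 < g i → ∃ N : ℕ, ∑ j, g j ≤ N • g i) :
    ∃ w : ι → ℝ, (∀ i, 0 < g i → 0 < w i) ∧ (∀ i, g i = 0 → w i = 0) ∧
      ∀ a b : ι → ℕ, ∑ i, w i * a i < ∑ i, w i * b i → ∑ i, a i • g i < ∑ i, b i • g i := by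
  have hle : ∀ i, g i ≤ ∑ j, g j := fun i =>
    Finset.single_le_sum (fun j _ => hg j) (Finset.mem_univ i)
  rcases (Finset.sum_nonneg fun j _ => hg j : 0 ≤ ∑ j, g j).eq_or_lt with h0 | hpos
  · exact ⟨0, fun i hi => absurd ((hle i).trans_eq h0.symm) hi.not_ge, fun _ _ => rfl, by simp⟩
  obtain ⟨φ, hφ, hφ_nonneg⟩ := exists_addMonoidHom_real_of_pos hpos
  have hφ_pos : ∀ i, 0 < g i → 0 < φ (g i) := fun i hi => by
    obtain ⟨N, hN⟩ := hbdd i hi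
    have h1 : 0 ≤ φ (g i) := hφ_nonneg _ (hg i) ⟨1, by simpa using hle i⟩
    have h2 : 0 ≤ φ (N • g i - ∑ j, g j) :=
      hφ_nonneg _ (sub_nonneg.mpr hN) ⟨N, (sub_le_self _ hpos.le).trans (by gcongr; exact hle i)⟩
    rw [map_sub, map_nsmul, nsmul_eq_mul, sub_nonneg] at h2
    exact h1.lt_of_ne fun h0 => hφ.not_ge (by rwa [← h0, mul_zero] at h2)
  refine ⟨fun i => φ (g i), hφ_pos, fun i hi => by simp only [hi, map_zero], fun a b hab => ?_⟩
  have hφ_sum : ∀ c : ι → ℕ, φ (∑ i, c i • g i) = ∑ i, φ (g i) * c i := fun c => by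
    simp only [map_sum, map_nsmul, nsmul_eq_mul, mul_comm]
  have hsum_nonneg : ∀ c : ι → ℕ, 0 ≤ ∑ i, c i • g i := fun c =>
    Finset.sum_nonneg fun i _ => nsmul_nonneg (hg i) _
  rw [← hφ_sum, ← hφ_sum, ← sub_pos, ← map_sub] at hab
  by_contra! hba
  refine hab.not_ge ?_
  rw [← neg_sub, map_neg, neg_nonpos]
  refine hφ_nonneg _ (sub_nonneg.mpr hba)
    ⟨∑ i, a i, (sub_le_self _ (hsum_nonneg b)).trans ?_⟩
  rw [← Finset.sum_nsmul_assoc]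
  exact Finset.sum_le_sum fun i _ => nsmul_le_nsmul_right (hle i) _

theorem exists_real_weight_of_le_one {Γ : Type*} [LinearOrderedCommGroupWithZero Γ] {ι : Type*}
    [Fintype ι] {γ : ι → Γ} (h0 : ∀ i, γ i ≠ 0) (hle : ∀ i, γ i ≤ 1)
    (hbdd : ∀ i, γ i < 1 → ∃ N : ℕ, γ i ^ N ≤ ∏ j, γ j) :
    ∃ w : ι → ℝ, (∀ i, γ i < 1 → 0 < w i) ∧ (∀ i, γ i = 1 → w i = 0) ∧
      ∀ a b : ι → ℕ, ∑ i, w i * a i < ∑ i, w i * b i → ∏ i, γ i ^ b i < ∏ i, γ i ^ a i := by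
  lift γ to ι → Γˣ using fun i => (h0 i).isUnit
  beta_reduce at hle hbdd ⊢
  norm_cast at hle hbdd ⊢
  obtain ⟨w, hpos, hzero, hlt⟩ := exists_real_weight_of_nonneg
    (g := fun i => Additive.ofMul (γ i)⁻¹)
    (fun i => show (1 : Γˣ) ≤ (γ i)⁻¹ from one_le_inv'.mpr (hle i)) fun i hi => by
      obtain ⟨N, hN⟩ := hbdd i (one_lt_inv'.mp hi)
      refine ⟨N, ?_⟩
      change ∏ j, (γ j)⁻¹ ≤ (γ i)⁻¹ ^ N
      rwa [Finset.prod_inv_distrib, inv_pow, inv_le_inv_iff]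
  refine ⟨w, fun i hi => hpos i (show 1 < (γ i)⁻¹ from one_lt_inv'.mpr hi),
    fun i hi => hzero i (show (γ i)⁻¹ = 1 from inv_eq_one.mpr hi), fun a b hab => ?_⟩
  have hprod : ∏ i, (γ i)⁻¹ ^ a i < ∏ i, (γ i)⁻¹ ^ b i := hlt a b hab
  simpa only [inv_pow, Finset.prod_inv_distrib, inv_lt_inv_iff] using hprod

end RealWeight

/-! ### Monomial substitutions -/

section Substitution

variable {R : Type*} [CommSemiring R] {n : ℕ} {N : Matrix (Fin n) (Fin n) ℤ} {b : Fin n → ℕ}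

/-- The exponent of `x ^ b` times the monomial with exponent `a` in the coordinates of `φ_N`; its
negative entries are truncated to `0`. -/
def shiftedExponent (N : Matrix (Fin n) (Fin n) ℤ) (b : Fin n → ℕ) (a : Fin n →₀ ℕ) :
    Fin n →₀ ℕ :=
  Finsupp.equivFunOnFinite.symm fun j => ((b j : ℤ) + (N *ᵥ fun i => (a i : ℤ)) j).toNat

/-- The product of `x ^ b` and `g ∘ φ_N`; it is meaningful if `ClearsDenominators N b g`. -/
def substitution (N : Matrix (Fin n) (Fin n) ℤ) (b : Fin n → ℕ) (g : MvPolynomial (Fin n) R) :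
    MvPolynomial (Fin n) R :=
  ∑ a ∈ g.support, monomial (shiftedExponent N b a) (g.coeff a)

/-- `x ^ b` clears the denominators of `g ∘ φ_N`, and only involves variables that occur in a
denominator of `φ_N`, so that it vanishes at no point where `φ_N` is regular. -/
structure ClearsDenominators (N : Matrix (Fin n) (Fin n) ℤ) (b : Fin n → ℕ)
    (g : MvPolynomial (Fin n) R) : Prop where
  exists_neg : ∀ j, b j ≠ 0 → ∃ i, N j i < 0
  nonneg : ∀ a ∈ g.support, ∀ j, 0 ≤ (b j : ℤ) + (N *ᵥ fun i => (a i : ℤ)) j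

theorem mulVec_natCast_nonneg {j : Fin n} (hN : ∀ i, 0 ≤ N j i) (a : Fin n →₀ ℕ) :
    0 ≤ (N *ᵥ fun i => (a i : ℤ)) j :=
  dotProduct_nonneg_of_nonneg hN fun i => Int.natCast_nonneg (a i)

theorem exists_clearsDenominators (N : Matrix (Fin n) (Fin n) ℤ) (g : MvPolynomial (Fin n) R) :
    ∃ b, ClearsDenominators N b g := by
  classical
  let B : Fin n → ℕ := fun j => ∑ a ∈ g.support, ((N *ᵥ fun i => (a i : ℤ)) j).natAbs
  refine ⟨fun j => if ∃ i, N j i < 0 then B j else 0, fun j hj => ?_, fun a ha j => ?_⟩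
  · exact (ite_ne_right_iff.mp hj).1
  · split_ifs with h
    · have hle : ((N *ᵥ fun i => (a i : ℤ)) j).natAbs ≤ B j :=
        Finset.single_le_sum (f := fun a : Fin n →₀ ℕ => ((N *ᵥ fun i => (a i : ℤ)) j).natAbs)
          (fun _ _ => Nat.zero_le _) ha
      omega
    · push Not at h
      simpa using mulVec_natCast_nonneg h a

theorem zpow_sum_of_nonneg {G₀ ι : Type*} [CommGroupWithZero G₀] {x : G₀} {c : ι → ℤ}
    (hc : x = 0 → ∀ i, 0 ≤ c i) (s : Finset ι) : x ^ ∑ i ∈ s, c i = ∏ i ∈ s, x ^ c i := by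
  classical
  induction s using Finset.induction_on with
  | empty => simp
  | insert i s hi ih =>
    rw [Finset.sum_insert hi, Finset.prod_insert hi, ← ih, zpow_add']
    refine or_iff_not_imp_left.mpr fun hx => ?_
    have h0 := hc (not_not.mp hx)
    have h1 := h0 i
    have h2 := Finset.sum_nonneg fun i (_ : i ∈ s) => h0 i
    omega

variable {K : Type*} [Field K]

theorem pow_shiftedExponent {g : MvPolynomial (Fin n) K} (hb : ClearsDenominators N b g)
    {x : Fin n → K} (hx : RegularAt N x) {a : Fin n →₀ ℕ} (ha : a ∈ g.support) (j : Fin n) :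
    x j ^ shiftedExponent N b a j = x j ^ b j * ∏ i, (x j ^ N j i) ^ a i := by
  have hN : x j = 0 → ∀ i, 0 ≤ N j i := fun hxj i => not_lt.mp fun hlt => hx i j hlt hxj
  have hbj : x j = 0 → b j = 0 := fun hxj => by
    by_contra hne
    obtain ⟨i, hi⟩ := hb.exists_neg j hne
    exact hi.not_ge (hN hxj i)
  have hprod : ∏ i, (x j ^ N j i) ^ a i = x j ^ (N *ᵥ fun i => (a i : ℤ)) j := by
    rw [Matrix.mulVec, dotProduct,
      zpow_sum_of_nonneg fun hxj i => mul_nonneg (hN hxj i) (Int.natCast_nonneg (a i))]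
    exact Finset.prod_congr rfl fun i _ => by rw [zpow_mul, zpow_natCast]
  have hexp : ((shiftedExponent N b a j : ℕ) : ℤ) = b j + (N *ᵥ fun i => (a i : ℤ)) j :=
    Int.toNat_of_nonneg (hb.nonneg a ha j)
  rw [hprod, ← zpow_natCast, ← zpow_natCast, hexp, zpow_add']
  refine or_iff_not_imp_left.mpr fun hxj => ?_
  have := hbj (not_not.mp hxj)
  omega

theorem eval_substitution {g : MvPolynomial (Fin n) K} (hb : ClearsDenominators N b g)
    {x : Fin n → K} (hx : RegularAt N x) :
    eval x (substitution N b g) = (∏ j, x j ^ b j) * eval (monomialMap N x) g := by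
  rw [substitution, map_sum, eval_eq', Finset.mul_sum]
  refine Finset.sum_congr rfl fun a ha => ?_
  rw [eval_monomial, Finsupp.prod_fintype _ _ fun i => pow_zero _, mul_left_comm]
  simp only [monomialMap, ← Finset.prod_pow]
  rw [Finset.prod_comm, ← Finset.prod_mul_distrib]
  exact congrArg _ (Finset.prod_congr rfl fun j _ => pow_shiftedExponent hb hx ha j)

theorem ClearsDenominators.prod_pow_ne_zero {g : MvPolynomial (Fin n) K}
    (hb : ClearsDenominators N b g) {x : Fin n → K} (hx : RegularAt N x) : ∏ j, x j ^ b j ≠ 0 := by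
  refine Finset.prod_ne_zero_iff.mpr fun j _ => ?_
  by_cases hbj : b j = 0
  · simp [hbj]
  · obtain ⟨i, hi⟩ := hb.exists_neg j hbj
    exact pow_ne_zero _ (hx i j hi)

theorem weight_shiftedExponent {g : MvPolynomial (Fin n) R} (hb : ClearsDenominators N b g)
    {a : Fin n →₀ ℕ} (ha : a ∈ g.support) (w : Fin n → ℝ) :
    weight w (shiftedExponent N b a) =
      w ⬝ᵥ (fun j => (b j : ℝ)) + weight (w ᵥ* N.map (Int.cast : ℤ → ℝ)) a := by
  have hexp : (fun j => ((shiftedExponent N b a j : ℕ) : ℝ)) =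
      (fun j => (b j : ℝ)) + N.map (Int.cast : ℤ → ℝ) *ᵥ fun i => (a i : ℝ) := by
    funext j
    have : ((shiftedExponent N b a j : ℕ) : ℤ) = b j + ∑ i, N j i * (a i : ℤ) :=
      Int.toNat_of_nonneg (hb.nonneg a ha j)
    simp only [Pi.add_apply, Matrix.mulVec, dotProduct, Matrix.map_apply]
    exact_mod_cast this
  change w ⬝ᵥ (fun j => ((shiftedExponent N b a j : ℕ) : ℝ)) = _
  rw [hexp, dotProduct_add, Matrix.dotProduct_mulVec]
  rfl

theorem HasLeadingMonomial.substitution {g : MvPolynomial (Fin n) R} {w : Fin n → ℝ}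
    {α : Fin n →₀ ℕ} (h : HasLeadingMonomial (w ᵥ* N.map (Int.cast : ℤ → ℝ)) g α)
    (hb : ClearsDenominators N b g) :
    HasLeadingMonomial w (substitution N b g) (shiftedExponent N b α) := by
  classical
  have hα : α ∈ g.support := mem_support_iff.mpr h.1
  have hlt : ∀ a ∈ g.support, a ≠ α →
      weight w (shiftedExponent N b α) < weight w (shiftedExponent N b a) := by
    intro a ha hne
    rw [weight_shiftedExponent hb ha, weight_shiftedExponent hb hα]
    exact add_lt_add_right (h.2 a ha hne) _
  constructor
  · rw [ToricTropical.substitution, coeff_sum, Finset.sum_eq_single α]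
    · simpa using h.1
    · intro a ha hne
      rw [coeff_monomial, if_neg]
      exact fun heq => (hlt a ha hne).ne (by rw [heq])
    · exact fun hnot => absurd hα hnot
  · intro ν hν hne
    obtain ⟨a, ha, hνa⟩ := Finset.mem_biUnion.mp (support_sum hν)
    obtain rfl : ν = shiftedExponent N b a := by
      simpa using support_monomial_subset hνa
    exact hlt a ha fun haα => hne (by rw [haα])

end Substitution

/-! ### The strict transform in the charts -/

section Charts

variable {K : Type*} [Field K] {n : ℕ}

theorem mem_zeroLocus_iff_eval {J : Ideal (MvPolynomial (Fin n) K)} {x : Fin n → K} :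
    x ∈ zeroLocus K J ↔ ∀ g ∈ J, eval x g = 0 := by
  simp only [mem_zeroLocus_iff, aeval_eq_eval]

theorem monomialMap_ne_zero {x : Fin n → K} (hx : ∀ i, x i ≠ 0)
    (N : Matrix (Fin n) (Fin n) ℤ) (i : Fin n) : monomialMap N x i ≠ 0 :=
  Finset.prod_ne_zero_iff.mpr fun j _ => zpow_ne_zero _ (hx j)

theorem regularAt_of_ne_zero {x : Fin n → K} (hx : ∀ i, x i ≠ 0)
    (N : Matrix (Fin n) (Fin n) ℤ) : RegularAt N x := fun _ j _ => hx j

theorem monomialMap_monomialMap {x : Fin n → K} (hx : ∀ i, x i ≠ 0)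
    (N N' : Matrix (Fin n) (Fin n) ℤ) :
    monomialMap N' (monomialMap N x) = monomialMap (N * N') x :=
  monomialMap_mul (regularAt_of_ne_zero hx N)
    (regularAt_of_ne_zero (monomialMap_ne_zero hx N) N')

theorem ne_zero_of_monomialMap_ne_zero {N : Matrix (Fin n) (Fin n) ℤ} {x : Fin n → K}
    (hx : ∀ i, monomialMap N x i ≠ 0) {j : Fin n} (hN : N j ≠ 0) : x j ≠ 0 := by
  intro h0
  obtain ⟨i, hi⟩ := Function.ne_iff.mp hN
  exact hx i (Finset.prod_eq_zero (Finset.mem_univ j) (by rw [h0, zero_zpow _ hi]))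

/-- The trace on the chart of `Cone(M)` of the preimage of the part of `V` in the torus. -/
def torusTrace (V : Set (Fin n → K)) (M : GL (Fin n) ℤ) : Set (Fin n → K) :=
  monomialMap M.valᵀ ⁻¹' {x ∈ V | ∀ i, x i ≠ 0}

/-- The ideal of the strict transform of `V` in the chart of `Cone(M)`. -/
def chartIdeal (V : Set (Fin n → K)) (M : GL (Fin n) ℤ) : Ideal (MvPolynomial (Fin n) K) :=
  vanishingIdeal K (torusTrace V M)

variable {V : Set (Fin n → K)} {M M' : GL (Fin n) ℤ} {x : Fin n → K}

theorem mem_chartIdeal_iff {g : MvPolynomial (Fin n) K} :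
    g ∈ chartIdeal V M ↔ ∀ x ∈ torusTrace V M, eval x g = 0 := by
  simp only [chartIdeal, mem_vanishingIdeal_iff, aeval_eq_eval]

theorem torusTrace_ne_zero (hx : x ∈ torusTrace V M) (i : Fin n) : x i ≠ 0 := by
  refine ne_zero_of_monomialMap_ne_zero hx.2 fun hrow => ?_
  exact (Matrix.isUnits_det_units M).ne_zero
    (Matrix.det_eq_zero_of_column_eq_zero i (congrFun hrow))

theorem monomialMap_transition_mem_torusTrace (hx : x ∈ torusTrace V M) :
    monomialMap (transition M M') x ∈ torusTrace V M' := by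
  rwa [torusTrace, Set.mem_preimage, monomialMap_monomialMap (torusTrace_ne_zero hx),
    transition_mul_transpose]

theorem monomialMap_inv_mem_torusTrace (hx : x ∈ V) (hx0 : ∀ i, x i ≠ 0) :
    monomialMap (M⁻¹).valᵀ x ∈ torusTrace V M := by
  rw [torusTrace, Set.mem_preimage, monomialMap_monomialMap hx0, ← Matrix.transpose_mul,
    Units.mul_inv, Matrix.transpose_one, monomialMap_one]
  exact ⟨hx, hx0⟩

theorem mem_chartIdeal_of_mul_prod_X_pow {g : MvPolynomial (Fin n) K} {N : ℕ}
    (h : g * (∏ i, X i) ^ N ∈ chartIdeal V M) : g ∈ chartIdeal V M := by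
  rw [mem_chartIdeal_iff] at h ⊢
  intro x hx
  have hgx := h x hx
  simp only [map_mul, map_pow, map_prod, eval_X] at hgx
  exact (mul_eq_zero.mp hgx).resolve_right
    (pow_ne_zero _ (Finset.prod_ne_zero_iff.mpr fun i _ => torusTrace_ne_zero hx i))

variable {F : RegularFan n}

theorem Glue.mem_zeroLocus_chartIdeal {p q : ChartPoint K F} (h : Glue p q)
    (hp : p.2 ∈ zeroLocus K (chartIdeal V p.1.1)) : q.2 ∈ zeroLocus K (chartIdeal V q.1.1) := by
  rw [mem_zeroLocus_iff_eval] at hp ⊢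
  intro g hg
  obtain ⟨b, hb⟩ := exists_clearsDenominators (transition p.1.1 q.1.1) g
  have hmem : substitution (transition p.1.1 q.1.1) b g ∈ chartIdeal V p.1.1 :=
    mem_chartIdeal_iff.mpr fun x hx => by
      rw [eval_substitution hb (regularAt_of_ne_zero (torusTrace_ne_zero hx) _),
        mem_chartIdeal_iff.mp hg _ (monomialMap_transition_mem_torusTrace hx), mul_zero]
  have hgp := hp _ hmem
  rw [eval_substitution hb h.1, h.2.2] at hgp
  exact (mul_eq_zero.mp hgp).resolve_left (hb.prod_pow_ne_zero h.1)

theorem strictTransform_subset : strictTransform F V ⊆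
    {z | ∀ (M : MaxCone F) x, z = chart K M x → x ∈ zeroLocus K (chartIdeal V M.1)} := by
  refine Set.sInter_subset_of_mem ⟨fun M => ⟨chartIdeal V M.1, Set.ext fun y => ?_⟩, ?_⟩
  · change _ ↔ ∀ g ∈ chartIdeal V M.1, eval y g = 0
    rw [← mem_zeroLocus_iff_eval]
    exact ⟨fun hy => hy M y rfl, fun hy M' y' heq =>
      Glue.mem_zeroLocus_chartIdeal (p := (M, y)) (q := (M', y')) (Quotient.exact heq) hy⟩
  · rintro _ hz M x rfl
    exact zeroLocus_vanishingIdeal_le _ hz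

theorem chart_mem_strictTransform_iff {M : MaxCone F} :
    chart K M x ∈ strictTransform F V ↔ x ∈ zeroLocus K (chartIdeal V M.1) := by
  refine ⟨fun h => strictTransform_subset h M x rfl, ?_⟩
  rintro hx Z ⟨hZ, hsub⟩
  obtain ⟨S, hS⟩ := hZ M
  change x ∈ chart K M ⁻¹' Z
  rw [hS]
  refine fun p hp => mem_zeroLocus_iff_eval.mp hx p (mem_chartIdeal_iff.mpr fun y hy => ?_)
  have hyZ : y ∈ chart K M ⁻¹' Z := hsub hy
  rw [hS] at hyZ
  exact hyZ p hp

end Charts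

/-! ### Tropical varieties in the charts -/

section ChartTropical

variable {K : Type*} [Field K] {n : ℕ}

theorem vecMul_transpose_map_intCast (M : GL (Fin n) ℤ) (c : Fin n → ℝ) :
    c ᵥ* M.valᵀ.map (Int.cast : ℤ → ℝ) = ∑ i, c i • column M i :=
  Matrix.vecMul_eq_sum _ _

theorem sum_smul_column_vecMul_inv (M : GL (Fin n) ℤ) (c : Fin n → ℝ) :
    (∑ i, c i • column M i) ᵥ* (M⁻¹).valᵀ.map (Int.cast : ℤ → ℝ) = c := by
  have hcast : M.valᵀ.map (Int.cast : ℤ → ℝ) * (M⁻¹).valᵀ.map (Int.cast : ℤ → ℝ) = 1 := by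
    rw [← Matrix.map_mul_intCast, ← Matrix.transpose_mul, Units.inv_mul, Matrix.transpose_one,
      Matrix.map_one _ Int.cast_zero Int.cast_one]
  rw [← vecMul_transpose_map_intCast, Matrix.vecMul_vecMul, hcast, Matrix.vecMul_one]

theorem prod_X_eq_monomial {R : Type*} [CommSemiring R] {σ : Type*} (s : Finset σ) :
    ∏ i ∈ s, X i = monomial (∑ i ∈ s, Finsupp.single i 1) (1 : R) :=
  (monomial_sum_one s _).symm

theorem substitution_mem_chartIdeal {I : Ideal (MvPolynomial (Fin n) K)} {M : GL (Fin n) ℤ}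
    {f : MvPolynomial (Fin n) K} (hf : f ∈ I) {b : Fin n → ℕ}
    (hb : ClearsDenominators M.valᵀ b f) :
    substitution M.valᵀ b f ∈ chartIdeal (zeroLocus K I) M :=
  mem_chartIdeal_iff.mpr fun x hx => by
    rw [eval_substitution hb (regularAt_of_ne_zero (torusTrace_ne_zero hx) _),
      mem_zeroLocus_iff_eval.mp hx.1 f hf, mul_zero]

theorem substitution_mul_prod_X_mem_radical [IsAlgClosed K] {I : Ideal (MvPolynomial (Fin n) K)}
    {M : GL (Fin n) ℤ} {g : MvPolynomial (Fin n) K} (hg : g ∈ chartIdeal (zeroLocus K I) M)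
    {b : Fin n → ℕ} (hb : ClearsDenominators (M⁻¹).valᵀ b g) :
    substitution (M⁻¹).valᵀ b g * ∏ i, X i ∈ I.radical := by
  rw [← vanishingIdeal_zeroLocus_eq_radical (K := K), mem_vanishingIdeal_iff]
  intro x hx
  rw [aeval_eq_eval, map_mul, map_prod]
  simp only [eval_X]
  by_cases hx0 : ∀ i, x i ≠ 0
  · rw [eval_substitution hb (regularAt_of_ne_zero hx0 _),
      mem_chartIdeal_iff.mp hg _ (monomialMap_inv_mem_torusTrace hx hx0), mul_zero, zero_mul]
  · push Not at hx0
    obtain ⟨i, hi⟩ := hx0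
    rw [Finset.prod_eq_zero (Finset.mem_univ i) hi, mul_zero]

theorem mem_tropicalVariety_chartIdeal_iff [IsAlgClosed K] {I : Ideal (MvPolynomial (Fin n) K)}
    {M : GL (Fin n) ℤ} {c : Fin n → ℝ} :
    c ∈ tropicalVariety (chartIdeal (zeroLocus K I) M) ↔
      ∑ i, c i • column M i ∈ tropicalVariety I := by
  rw [← not_iff_not, notMem_tropicalVariety_iff, notMem_tropicalVariety_iff]
  constructor
  · rintro ⟨g, hg, α, hα⟩
    obtain ⟨b, hb⟩ := exists_clearsDenominators (M⁻¹).valᵀ g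
    obtain ⟨k, hk⟩ := substitution_mul_prod_X_mem_radical hg hb
    rw [← sum_smul_column_vecMul_inv M c] at hα
    have hX : HasLeadingMonomial (∑ i, c i • column M i) (∏ i, X i : MvPolynomial (Fin n) K)
        (∑ i, Finsupp.single i 1) := by
      rw [prod_X_eq_monomial]
      exact .of_monomial _ _ one_ne_zero
    exact ⟨_, hk, _, ((hα.substitution hb).mul hX).pow k⟩
  · rintro ⟨f, hf, μ, hμ⟩
    obtain ⟨b, hb⟩ := exists_clearsDenominators M.valᵀ f
    rw [← vecMul_transpose_map_intCast] at hμ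
    exact ⟨_, substitution_mem_chartIdeal hf hb, _, hμ.substitution hb⟩

end ChartTropical

/-! ### Points of a stratum and weights -/

section Strata

variable {K : Type*} [Field K] {n : ℕ}

theorem valuation_monomial {R σ Γ : Type*} [CommRing R] [LinearOrderedCommMonoidWithZero Γ]
    (v : Valuation (MvPolynomial σ R) Γ) (μ : σ →₀ ℕ) (c : R) :
    v (monomial μ c) = v (C c) * μ.prod fun i k => v (X i) ^ k := by
  rw [monomial_eq, map_mul, Finsupp.prod, map_prod]
  simp only [map_pow, Finsupp.prod]

theorem HasLeadingMonomial.valuation_ne_zero {R Γ : Type*} [CommRing R]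
    [LinearOrderedCommGroupWithZero Γ] {v : Valuation (MvPolynomial (Fin n) R) Γ}
    (hC : ∀ c ≠ 0, v (C c) = 1) (hX : ∀ i, v (X i) ≠ 0) {w : Fin n → ℝ}
    (hw : ∀ a b : Fin n → ℕ, ∑ i, w i * a i < ∑ i, w i * b i →
      ∏ i, v (X i) ^ b i < ∏ i, v (X i) ^ a i)
    {g : MvPolynomial (Fin n) R} {α : Fin n →₀ ℕ} (hg : HasLeadingMonomial w g α) :
    v g ≠ 0 := by
  have hv : ∀ μ ∈ g.support, v (monomial μ (g.coeff μ)) = ∏ i, v (X i) ^ μ i := fun μ hμ => by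
    rw [valuation_monomial, hC _ (mem_support_iff.mp hμ), one_mul,
      Finsupp.prod_fintype _ _ fun i => pow_zero _]
  have hα : α ∈ g.support := mem_support_iff.mpr hg.1
  have hne : v (monomial α (g.coeff α)) ≠ 0 := by
    rw [hv α hα]
    exact Finset.prod_ne_zero_iff.mpr fun i _ => pow_ne_zero _ (hX i)
  rw [g.as_sum, ← Finset.add_sum_erase _ _ hα, Valuation.map_add_eq_of_lt_left]
  · exact hne
  · refine v.map_sum_lt hne fun μ hμ => ?_
    obtain ⟨hμα, hμ⟩ := Finset.mem_erase.mp hμ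
    rw [hv α hα, hv μ hμ]
    exact hw α μ (hg.2 μ hμ hμα)

theorem exists_mem_tropicalVariety_of_mem_zeroLocus {J : Ideal (MvPolynomial (Fin n) K)}
    (hJ : ∀ (g : MvPolynomial (Fin n) K) (N : ℕ), g * (∏ i, X i) ^ N ∈ J → g ∈ J)
    {x : Fin n → K} (hx : x ∈ zeroLocus K J) :
    ∃ c ∈ tropicalVariety J, (∀ i, x i = 0 → 0 < c i) ∧ ∀ i, x i ≠ 0 → c i = 0 := by
  have : (RingHom.ker (eval x)).IsPrime := RingHom.ker_isPrime _
  obtain ⟨Γ, _, v, hle, hlt, hvJ, hvX, hpow⟩ := exists_valuation_of_forall_mul_pow_notMem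
    (J := J) (m := RingHom.ker (eval x)) (h := ∏ i, X i)
    fun g hg N hgN => hg (mem_zeroLocus_iff_eval.mp hx g (hJ g N hgN))
  have hunit : ∀ g, eval x g ≠ 0 → v g = 1 := fun g hg =>
    (hle g).antisymm (not_lt.mp fun h => hg ((hlt g).mp h))
  have hlt_one : ∀ i, x i = 0 → v (X i) < 1 := fun i hi =>
    (hlt _).mpr (by rw [RingHom.mem_ker, eval_X, hi])
  rw [map_prod] at hvX hpow
  have hX : ∀ i, v (X i) ≠ 0 := fun i => Finset.prod_ne_zero_iff.mp hvX i (Finset.mem_univ i)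
  obtain ⟨w, hpos, hzero, hw⟩ :=
    exists_real_weight_of_le_one hX (fun i => hle _) fun i => hpow (X i)
  refine ⟨w, ?_, fun i hi => hpos i (hlt_one i hi),
    fun i hi => hzero i (hunit _ (by rwa [eval_X]))⟩
  by_contra hmem
  obtain ⟨g, hg, α, hα⟩ := notMem_tropicalVariety_iff.mp hmem
  exact hα.valuation_ne_zero (fun c hc => hunit _ (by rwa [eval_C])) hX hw (hvJ g hg)

theorem HasLeadingMonomial.monomial_sub {R : Type*} [CommRing R] [Nontrivial R]
    {s : Finset (Fin n)} {c : Fin n → ℝ} (hpos : ∀ i ∈ s, 0 < c i) (hzero : ∀ i ∉ s, c i = 0)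
    {α : Fin n →₀ ℕ} (hα : ∀ i ∈ s, α i = 0) {r : MvPolynomial (Fin n) R}
    (hr : r ∈ Ideal.span (X '' (s : Set (Fin n)))) :
    HasLeadingMonomial c (monomial α 1 - r) α := by
  rw [mem_ideal_span_X_image] at hr
  have hc : ∀ i, 0 ≤ c i := fun i =>
    if hi : i ∈ s then (hpos i hi).le else (hzero i hi).ge
  have hαc : weight c α = 0 := Finset.sum_eq_zero fun i _ => by
    by_cases hi : i ∈ s
    · rw [hα i hi, Nat.cast_zero, mul_zero]
    · rw [hzero i hi, zero_mul]
  constructor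
  · have hαr : r.coeff α = 0 := by
      by_contra h0
      obtain ⟨i, hi, hαi⟩ := hr α (mem_support_iff.mpr h0)
      exact hαi (hα i hi)
    rw [coeff_sub, coeff_monomial, if_pos rfl, hαr, sub_zero]
    exact one_ne_zero
  · intro ν hν hne
    rw [mem_support_iff, coeff_sub, coeff_monomial, if_neg hne.symm, zero_sub, neg_ne_zero] at hν
    obtain ⟨i, hi, hνi⟩ := hr ν (mem_support_iff.mpr hν)
    rw [hαc]
    exact Finset.sum_pos' (fun j _ => mul_nonneg (hc j) (Nat.cast_nonneg _))
      ⟨i, Finset.mem_univ i, mul_pos (hpos i hi) (Nat.cast_pos.mpr (Nat.pos_of_ne_zero hνi))⟩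

theorem prod_X_mem_radical_sup_span_X [IsAlgClosed K] {J : Ideal (MvPolynomial (Fin n) K)}
    {s : Finset (Fin n)} (h : ∀ x ∈ zeroLocus K J, ¬ ∀ i, x i = 0 ↔ i ∈ s) :
    ∏ i ∈ sᶜ, X i ∈ (J ⊔ Ideal.span (X '' (s : Set (Fin n)))).radical := by
  rw [← vanishingIdeal_zeroLocus_eq_radical (K := K), mem_vanishingIdeal_iff]
  intro x hx
  rw [mem_zeroLocus_iff_eval] at hx
  simp only [map_prod, aeval_X]
  by_contra hne
  refine h x (mem_zeroLocus_iff_eval.mpr fun g hg => hx g (Ideal.mem_sup_left hg)) fun i =>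
    ⟨fun h0 => ?_, fun hi => ?_⟩
  · by_contra hi
    exact hne (Finset.prod_eq_zero (Finset.mem_compl.mpr hi) h0)
  · simpa only [eval_X] using
      hx (X i) (Ideal.mem_sup_right (Ideal.subset_span (Set.mem_image_of_mem X hi)))

theorem exists_mem_zeroLocus_of_mem_tropicalVariety [IsAlgClosed K]
    {J : Ideal (MvPolynomial (Fin n) K)} {s : Finset (Fin n)} {c : Fin n → ℝ}
    (hc : c ∈ tropicalVariety J) (hpos : ∀ i ∈ s, 0 < c i) (hzero : ∀ i ∉ s, c i = 0) :
    ∃ x ∈ zeroLocus K J, ∀ i, x i = 0 ↔ i ∈ s := by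
  by_contra h
  obtain ⟨N, hN⟩ := prod_X_mem_radical_sup_span_X fun x hx hxs => h ⟨x, hx, hxs⟩
  rw [prod_X_eq_monomial, monomial_pow, one_pow] at hN
  obtain ⟨g, hg, r, hr, hgr⟩ := Submodule.mem_sup.mp hN
  have hα : ∀ i ∈ s, (N • ∑ j ∈ sᶜ, Finsupp.single j 1 : Fin n →₀ ℕ) i = 0 := fun i hi => by
    simp [Finsupp.single_apply, hi]
  rw [eq_sub_of_add_eq hgr] at hg
  exact notMem_tropicalVariety_iff.mpr ⟨_, hg, _, .monomial_sub hpos hzero hα hr⟩ hc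

end Strata

end ToricTropical

end

theorem theorem13p2_general {K : Type*} [Field K] [IsAlgClosed K] {n : ℕ}
    (I : Ideal (MvPolynomial (Fin n) K)) (F : ToricTropical.RegularFan n)
    (hcover : ToricTropical.orthant n ⊆ ⋃₀ F.cones) {τ : Set (Fin n → ℝ)} (hτ : τ ∈ F.cones) :
    (ToricTropical.strictTransform F (MvPolynomial.zeroLocus K I) ∩
        ToricTropical.orbit K F τ).Nonempty ↔
      (ToricTropical.relInterior τ ∩ ToricTropical.tropicalVariety I).Nonempty := by
  open ToricTropical in
  constructor
  · rintro ⟨_, hz, M, s, x, rfl, hxs, rfl⟩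
    obtain ⟨c, hc, hpos, hzero⟩ := exists_mem_tropicalVariety_of_mem_zeroLocus
      (fun _ _ => mem_chartIdeal_of_mul_prod_X_pow) (chart_mem_strictTransform_iff.mp hz)
    exact ⟨∑ i, c i • column M.1 i, mem_relInterior_coneGen_column_iff.mpr
      ⟨c, fun i hi => hpos i ((hxs i).mpr hi), fun i hi => hzero i (mt (hxs i).mp hi), rfl⟩,
      mem_tropicalVariety_chartIdeal_iff.mp hc⟩
  · rintro ⟨w, hwτ, hwI⟩
    obtain ⟨M, s, rfl⟩ := F.exists_eq_coneGen_column hcover hτ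
    obtain ⟨c, hpos, hzero, rfl⟩ := mem_relInterior_coneGen_column_iff.mp hwτ
    obtain ⟨x, hx, hxs⟩ := exists_mem_zeroLocus_of_mem_tropicalVariety
      (mem_tropicalVariety_chartIdeal_iff.mpr hwI) hpos hzero
    exact ⟨chart K M x, chart_mem_strictTransform_iff.mpr hx, M, s, x, rfl, hxs, rfl⟩

theorem theorem13p2 {K : Type*} [Field K] [IsAlgClosed K] {n : ℕ}
    (I : Ideal (MvPolynomial (Fin n) K)) (F : ToricTropical.RegularFan n)
    (hF : ToricTropical.IsRefinement F.cones (ToricTropical.groebnerFan I))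
    (τ : Set (Fin n → ℝ)) (hτ : τ ∈ F.cones) :
    (ToricTropical.strictTransform F (MvPolynomial.zeroLocus K I) ∩
        ToricTropical.orbit K F τ).Nonempty ↔
      τ ⊆ ToricTropical.tropicalVariety I :=
  (theorem13p2_general I F hF.orthant_subset_sUnion hτ).trans
    (ToricTropical.relInterior_inter_tropicalVariety_nonempty_iff hF hτ)
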